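/- \textbf{Proposition (Going up).} Let $K$ be an algebraically closed field, let $q$ be a prime number ($q=\operatorname{char} K$ is allowed), and let $H$ be a finite abelian group of order $q^n$, $n\ge 0$. Let $X$ and $Z$ be irreducible $K$-schemes on which $H$ acts by $K$-automorphisms, and let $p: X \dashrightarrow Z$ be an $H$-equivariant rational map over $K$. Assume that \begin{enumerate} \item $p$ is dominant and generically finite, and its degree $\deg(X/Z)$, that is, the degree of the extension of the residue field of $Z$ at its generic point by the residue field of $X$ at its generic point (for integral $X$, $Z$: the extension $K(X)/K(Z)$ of the fields of rational functions), is not divisible by $q$; \item $H$ has a smooth fixed point on $Z$, that is, there is a $K$-point of $Z$ that is fixed by $H$ and at which $Z$ is smooth over $K$; and \item $X$ is proper over $K$. \end{enumerate} Then $H$ has a fixed point on $X$, that is, some $K$-point of $X$ is fixed by $H$. Moreover, if $Y$ is a proper $K$-scheme on which $H$ acts by $K$-automorphisms and there is an $H$-equivariant rational map $X \dashrightarrow Y$ over $K$, then $H$ has a fixed point on $Y$. -/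

import Mathlib

open CategoryTheory AlgebraicGeometry

universe u v

namespace GoingUp

/-- An action of a group `H` on an `S`-scheme `X` by automorphisms of `X` over `S`.
(Multiplication in `Aut X` is composition of maps, so this is a left action.) -/
structure SchemeAction (S : Scheme.{u}) (H : Type v) [Group H] (X : Scheme.{u}) [X.Over S] where
  toAut : H →* Aut X
  isOver : ∀ h : H, (toAut h).hom.IsOver S

/-- The automorphism by which `h` acts, as a morphism. -/
def SchemeAction.act {S : Scheme.{u}} {H : Type v} [Group H] {X : Scheme.{u}} [X.Over S]
    (ρ : SchemeAction S H X) (h : H) : X ⟶ X :=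
  (ρ.toAut h).hom

instance {S : Scheme.{u}} {H : Type v} [Group H] {X : Scheme.{u}} [X.Over S]
    (ρ : SchemeAction S H X) (h : H) : IsIso (ρ.act h) :=
  Iso.isIso_hom (ρ.toAut h : X ≅ X)

/-- A `K`-point `x : Spec K ⟶ X` of the `K`-scheme `X` is fixed by the action. -/
structure SchemeAction.IsFixedPoint {K : Type u} [Field K] {H : Type v} [Group H]
    {X : Scheme.{u}} [X.Over (Spec (.of K))] (ρ : SchemeAction (Spec (.of K)) H X)
    (x : Spec (.of K) ⟶ X) : Prop where
  comp_over : x ≫ (X ↘ Spec (.of K)) = 𝟙 (Spec (.of K))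
  comp_act : ∀ h : H, x ≫ ρ.act h = x

/-- `H` has a fixed point on `X`. -/
def SchemeAction.HasFixedPoint {K : Type u} [Field K] {H : Type v} [Group H]
    {X : Scheme.{u}} [X.Over (Spec (.of K))] (ρ : SchemeAction (Spec (.of K)) H X) : Prop :=
  ∃ x : Spec (.of K) ⟶ X, ρ.IsFixedPoint x

/-- `H` has a fixed point at which `X` is smooth over `K`. -/
def SchemeAction.HasSmoothFixedPoint {K : Type u} [Field K] {H : Type v} [Group H]
    {X : Scheme.{u}} [X.Over (Spec (.of K))] (ρ : SchemeAction (Spec (.of K)) H X) : Prop :=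
  ∃ x : Spec (.of K) ⟶ X, ρ.IsFixedPoint x ∧
    ∃ U : X.Opens, x (IsLocalRing.closedPoint K) ∈ U ∧ Smooth (U.ι ≫ (X ↘ Spec (.of K)))

/-- A rational map `f : X ⤏ Y` is `H`-equivariant if `f ∘ h = h ∘ f` as rational maps, for
every `h` in `H`. -/
def IsEquivariant {S : Scheme.{u}} {H : Type v} [Group H] {X Y : Scheme.{u}} [X.Over S]
    [Y.Over S] [IrreducibleSpace X] (ρX : SchemeAction S H X) (ρY : SchemeAction S H Y)
    (f : X ⤏ Y) : Prop :=
  ∀ h : H, (ρX.act h).toRationalMap.comp f = f.compHom (ρY.act h)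

/-- A rational map `f : X ⤏ Z` from an irreducible scheme is generically finite if the residue
field of `X` at its generic point `ξ` is a finite extension of the residue field of `Z` at the
image of `ξ`. When `X` and `Z` are integral and `f` is dominant, these are the fields of rational
functions of `X` and `Z`. -/
def IsGenericallyFinite {X Z : Scheme.{u}} [IrreducibleSpace X] (f : X ⤏ Z) : Prop :=
  (f.fromFunctionField.residueFieldMap (IsLocalRing.closedPoint X.functionField)).hom.Finite

/-- The degree of a rational map `f : X ⤏ Z` from an irreducible scheme: the degree of the residue
field of `X` at its generic point `ξ` over the residue field of `Z` at the image of `ξ`. -/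
noncomputable def degree {X Z : Scheme.{u}} [IrreducibleSpace X] (f : X ⤏ Z) : ℕ :=
  f.fromFunctionField.residueDegree (IsLocalRing.closedPoint X.functionField)

end GoingUp

/-! Everything reduces to one object: an `H`-invariant valuation ring `W`, containing `K` and with
residue field `K`, in the residue field `L` of `X` at its generic point. Given `W`, an equivariant
rational map from `X` to a proper scheme restricts to an equivariant `L`-point. The valuative
criterion extends it uniquely to `Spec W`, uniqueness makes the extension equivariant, and `H` acts
trivially on the residue field `K`, so the closed point maps to a fixed point
(`hasFixedPoint_of_valuationSubring`). The generic point of `X` itself is handled in the same way.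

On `Z`, let `R` be the local ring at the smooth fixed point. The commutative group `H` acts on the
cotangent space, and over an algebraically closed field commuting operators are simultaneously
triangular; diagonalization, which may fail if `q` is the characteristic, is not needed. Lift a
triangular basis to parameters `t` and order monomials by degree, then lexicographically. Formal
smoothness makes the monomials independent in the graded sense, so the smallest exponent in the
expansion of an element is a valuation. It has residue field `K`, and triangularity makes it
invariant (`exists_invariant_valuationSubring_of_formallySmooth`).

The field `M` of fractions of `R` is the residue field of `Z` at its generic point. To pass from `M`
to `L`, count the valuation rings of `L` over the given one, weighted by the embeddings of `L` in a
normal extension that induce them. The total weight is the separable degree, which divides `[L : M]`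
and so is prime to `q`; the weights are `H`-invariant, so the `q`-group `H` fixes one of these rings
(`exists_invariant_valuationSubring_of_normal`). Its residue field is algebraic over `K`, hence
equal to `K`. -/

namespace GoingUp


/-! ### Simultaneous triangularization of commuting operators. -/

section Triangularization

variable {K : Type*} [Field K] [IsAlgClosed K] {H : Type*} [CommMonoid H]

/-- A commuting family of endomorphisms of a nonzero finite-dimensional vector space over an
algebraically closed field has a common eigenvector. -/
theorem exists_common_eigenvector {V : Type*} [AddCommGroup V] [Module K V]
    [FiniteDimensional K V] (ρ : H →* Module.End K V) (N : Submodule K V) (hN : N ≠ ⊥)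
    (hinv : ∀ h, ∀ x ∈ N, ρ h x ∈ N) :
    ∃ x ∈ N, x ≠ 0 ∧ ∀ h, ∃ c : K, ρ h x = c • x := by
  induction hd : Module.finrank K N using Nat.strong_induction_on generalizing N with
  | _ d ih =>
    by_cases hs : ∀ h, ∃ c : K, ∀ x ∈ N, ρ h x = c • x
    · obtain ⟨x, hx, hx0⟩ := N.ne_bot_iff.mp hN
      exact ⟨x, hx, hx0, fun h ↦ (hs h).imp fun c hc ↦ hc x hx⟩
    · push Not at hs
      obtain ⟨g, hg⟩ := hs
      have : Nontrivial N := Submodule.nontrivial_iff_ne_bot.mpr hN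
      obtain ⟨c, hc⟩ := Module.End.exists_eigenvalue ((ρ g).restrict (hinv g))
      obtain ⟨⟨y, hyN⟩, hy⟩ := hc.exists_hasEigenvector
      have hy0 : y ≠ 0 := fun h0 ↦ hy.2 (Subtype.ext h0)
      have hyc : ρ g y = c • y := congr_arg Subtype.val hy.apply_eq_smul
      let N' : Submodule K V := N ⊓ Module.End.eigenspace (ρ g) c
      have hyN' : y ∈ N' := ⟨hyN, Module.End.mem_eigenspace_iff.mpr hyc⟩
      have hlt : N' < N := by
        refine lt_of_le_of_ne inf_le_left fun he ↦ ?_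
        obtain ⟨x, hx, hxc⟩ := hg c
        exact hxc (Module.End.mem_eigenspace_iff.mp (he.ge hx).2)
      obtain ⟨x, hx, hx'⟩ := ih _ (hd ▸ Submodule.finrank_lt_finrank_of_lt hlt) N'
        (N'.ne_bot_iff.mpr ⟨y, hyN', hy0⟩) (fun h x hx ↦ ⟨hinv h x hx.1, by
          refine Module.End.mem_eigenspace_iff.mpr ?_
          rw [← Module.End.mul_apply, ← map_mul, mul_comm, map_mul,
            Module.End.mul_apply, Module.End.mem_eigenspace_iff.mp hx.2, map_smul]⟩) rfl
      exact ⟨x, hx.1, hx'⟩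

/-- A commuting family of endomorphisms of a nonzero finite-dimensional vector space over an
algebraically closed field has an invariant hyperplane. -/
theorem exists_invariant_hyperplane {V : Type*} [AddCommGroup V] [Module K V]
    [FiniteDimensional K V] [Nontrivial V] (ρ : H →* Module.End K V) :
    ∃ f : Module.Dual K V, f ≠ 0 ∧ ∀ h, ∃ c : K, ∀ x, f (ρ h x) = c * f x := by
  -- An invariant hyperplane is the kernel of a common eigenvector of the transposes. Transposition
  -- reverses products, which is harmless because `H` is commutative.
  let ρ' : H →* Module.End K (Module.Dual K V) :=
    { toFun := fun h ↦ (ρ h).dualMap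
      map_one' := by ext; simp
      map_mul' := fun a b ↦ by
        ext f x
        rw [mul_comm a b]
        simp [LinearMap.dualMap_apply] }
  obtain ⟨f, -, hf0, hf⟩ := exists_common_eigenvector ρ' ⊤ top_ne_bot fun _ _ _ ↦ trivial
  refine ⟨f, hf0, fun h ↦ (hf h).imp fun c hc x ↦ ?_⟩
  exact LinearMap.congr_fun hc x

/-- A commuting family of endomorphisms of a finite-dimensional vector space over an algebraically
closed field is simultaneously triangularizable. -/
theorem exists_upper_triangular_basis (n : ℕ) {V : Type*} [AddCommGroup V] [Module K V]
    [FiniteDimensional K V] (hn : Module.finrank K V = n) (ρ : H →* Module.End K V) :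
    ∃ b : Module.Basis (Fin n) K V, ∀ h i, ρ h (b i) ∈ Submodule.span K (b '' {j | i ≤ j}) := by
  induction n generalizing V with
  | zero =>
    exact ⟨Module.finBasisOfFinrankEq K V hn, fun h i ↦ i.elim0⟩
  | succ n ih =>
    have : Nontrivial V := Module.nontrivial_of_finrank_pos (R := K) (by omega)
    obtain ⟨f, hf0, hf⟩ := exists_invariant_hyperplane ρ
    have hinv : ∀ h, ∀ x ∈ LinearMap.ker f, ρ h x ∈ LinearMap.ker f := fun h x hx ↦ by
      obtain ⟨c, hc⟩ := hf h
      rw [LinearMap.mem_ker] at hx ⊢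
      rw [hc, hx, mul_zero]
    let ρ' : H →* Module.End K (LinearMap.ker f) :=
      { toFun := fun h ↦ (ρ h).restrict (hinv h)
        map_one' := by ext; simp
        map_mul' := fun a b ↦ by ext; simp }
    have hfr : Module.finrank K (LinearMap.ker f) = n := by
      have := Module.Dual.finrank_ker_add_one_of_ne_zero hf0
      omega
    obtain ⟨b, hb⟩ := ih hfr ρ'
    obtain ⟨y, hy⟩ : ∃ y, f y ≠ 0 := by
      by_contra! h
      exact hf0 (LinearMap.ext h)
    -- The vector off the hyperplane comes first, so the spans of the tails of the basis are the
    -- invariant subspaces.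
    let B : Module.Basis (Fin (n + 1)) K V := Module.Basis.mkFinCons y b
      (fun c x hx h0 ↦ by
        have := congr_arg f h0
        rw [map_add, map_smul, LinearMap.mem_ker.mp hx, add_zero, map_zero, smul_eq_mul] at this
        exact (mul_eq_zero.mp this).resolve_right hy)
      (fun z ↦ ⟨-(f z / f y), by
        rw [LinearMap.mem_ker, map_add, map_smul, smul_eq_mul]
        field_simp
        ring⟩)
    have hB0 : B 0 = y := by simp [B]
    have hBs : ∀ i : Fin n, B i.succ = b i := by simp [B]
    refine ⟨B, fun h i ↦ ?_⟩
    cases i using Fin.cases with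
    | zero =>
      have : (B '' {j | 0 ≤ j}) = Set.range B := by simp
      rw [this, B.span_eq]
      trivial
    | succ i =>
      have h1 : ((ρ' h (b i) : LinearMap.ker f) : V) ∈
          (Submodule.span K (b '' {j | i ≤ j})).map (LinearMap.ker f).subtype :=
        Submodule.mem_map_of_mem (hb h i)
      rw [Submodule.map_span] at h1
      rw [hBs]
      refine Submodule.span_mono ?_ h1
      rintro _ ⟨_, ⟨j, hj, rfl⟩, rfl⟩
      exact ⟨j.succ, by simpa using hj, by simp [hBs]⟩

/-- Reversing the basis adapts it to `DegLex`, where the variable of smaller index is the larger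
monomial: each parameter will be sent to a combination of itself and larger ones, modulo degree two.
-/
theorem exists_lower_triangular_basis {V : Type*} [AddCommGroup V] [Module K V]
    [FiniteDimensional K V] (ρ : H →* Module.End K V) :
    ∃ b : Module.Basis (Fin (Module.finrank K V)) K V,
      ∀ h i, ρ h (b i) ∈ Submodule.span K (b '' {j | j ≤ i}) := by
  obtain ⟨b, hb⟩ := exists_upper_triangular_basis _ rfl ρ
  refine ⟨b.reindex Fin.revPerm, fun h i ↦ ?_⟩
  have := hb h i.rev
  simp only [Module.Basis.coe_reindex, Function.comp_apply, Fin.revPerm_symm, Fin.revPerm_apply]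
  refine Submodule.span_mono ?_ this
  rintro _ ⟨j, hj, rfl⟩
  exact ⟨j.rev, by simpa [Fin.rev_le_iff] using hj, by simp⟩

end Triangularization


/-! ### The filtration of a ring by monomials in degree-lexicographic order. -/

section MonomialFiltration

open IsLocalRing

variable {R : Type*} [CommRing R] {n : ℕ} (t : Fin n → R)

/-- The value of a monomial at the family `t`. -/
noncomputable def monomialValue (β : DegLex (Fin n →₀ ℕ)) : R :=
  (ofDegLex β).prod fun i k ↦ t i ^ k

theorem monomialValue_add (β γ : DegLex (Fin n →₀ ℕ)) :
    monomialValue t (β + γ) = monomialValue t β * monomialValue t γ :=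
  Finsupp.prod_add_index' (fun _ ↦ pow_zero _) (fun _ _ _ ↦ pow_add _ _ _)

theorem monomialValue_zero : monomialValue t 0 = 1 := Finsupp.prod_zero_index

theorem monomialValue_single (i : Fin n) (k : ℕ) :
    monomialValue t (toDegLex (Finsupp.single i k)) = t i ^ k :=
  Finsupp.prod_single_index (pow_zero _)

/-- The ideal generated by the monomials in `t` that are at least `γ`. -/
noncomputable def monomialIdeal (γ : DegLex (Fin n →₀ ℕ)) : Ideal R :=
  Ideal.span (monomialValue t '' Set.Ici γ)

/-- The ideal generated by the monomials in `t` that are greater than `γ`. -/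
noncomputable def strictMonomialIdeal (γ : DegLex (Fin n →₀ ℕ)) : Ideal R :=
  Ideal.span (monomialValue t '' Set.Ioi γ)

variable {t}

theorem monomialIdeal_anti {γ δ : DegLex (Fin n →₀ ℕ)} (h : γ ≤ δ) :
    monomialIdeal t δ ≤ monomialIdeal t γ :=
  Ideal.span_mono (Set.image_mono (Set.Ici_subset_Ici.mpr h))

theorem monomialIdeal_le_strict {γ δ : DegLex (Fin n →₀ ℕ)} (h : γ < δ) :
    monomialIdeal t δ ≤ strictMonomialIdeal t γ :=
  Ideal.span_mono (Set.image_mono (Set.Ici_subset_Ioi.mpr h))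

theorem strictMonomialIdeal_le (γ : DegLex (Fin n →₀ ℕ)) :
    strictMonomialIdeal t γ ≤ monomialIdeal t γ :=
  Ideal.span_mono (Set.image_mono Set.Ioi_subset_Ici_self)

theorem monomialValue_mem {β γ : DegLex (Fin n →₀ ℕ)} (h : γ ≤ β) :
    monomialValue t β ∈ monomialIdeal t γ :=
  Ideal.subset_span ⟨β, h, rfl⟩

theorem monomialValue_mem_strict {β γ : DegLex (Fin n →₀ ℕ)} (h : γ < β) :
    monomialValue t β ∈ strictMonomialIdeal t γ :=
  Ideal.subset_span ⟨β, h, rfl⟩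

theorem monomialIdeal_zero : monomialIdeal t 0 = ⊤ :=
  (Ideal.eq_top_iff_one _).mpr (monomialValue_zero t ▸ monomialValue_mem le_rfl)

theorem mul_mem_monomialIdeal {γ δ : DegLex (Fin n →₀ ℕ)} {x y : R}
    (hx : x ∈ monomialIdeal t γ) (hy : y ∈ monomialIdeal t δ) :
    x * y ∈ monomialIdeal t (γ + δ) := by
  have := Ideal.mul_mem_mul hx hy
  rw [monomialIdeal, monomialIdeal, Ideal.span_mul_span'] at this
  refine Ideal.span_mono ?_ this
  rintro _ ⟨_, ⟨a, ha, rfl⟩, _, ⟨b, hb, rfl⟩, rfl⟩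
  exact ⟨a + b, Set.mem_Ici.mpr (add_le_add (Set.mem_Ici.mp ha) (Set.mem_Ici.mp hb)),
    monomialValue_add t a b⟩

theorem mul_mem_strictMonomialIdeal {γ δ : DegLex (Fin n →₀ ℕ)} {x y : R}
    (hx : x ∈ monomialIdeal t γ) (hy : y ∈ strictMonomialIdeal t δ) :
    x * y ∈ strictMonomialIdeal t (γ + δ) := by
  have := Ideal.mul_mem_mul hx hy
  rw [monomialIdeal, strictMonomialIdeal, Ideal.span_mul_span'] at this
  refine Ideal.span_mono ?_ this
  rintro _ ⟨_, ⟨a, ha, rfl⟩, _, ⟨b, hb, rfl⟩, rfl⟩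
  exact ⟨a + b, Set.mem_Ioi.mpr (add_lt_add_of_le_of_lt (Set.mem_Ici.mp ha) (Set.mem_Ioi.mp hb)),
    monomialValue_add t a b⟩

/-- The filtration is multiplicative in the exponent, so a ring endomorphism respects all of it once
it does so on the parameters. -/
theorem map_mem_monomialIdeal (f : R →+* R)
    (hf : ∀ i, f (t i) ∈ monomialIdeal t (toDegLex (Finsupp.single i 1)))
    {γ : DegLex (Fin n →₀ ℕ)} {x : R} (hx : x ∈ monomialIdeal t γ) :
    f x ∈ monomialIdeal t γ := by
  have key : ∀ β : Fin n →₀ ℕ,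
      f (monomialValue t (toDegLex β)) ∈ monomialIdeal t (toDegLex β) := by
    intro β
    induction β using Finsupp.induction_linear with
    | zero =>
      have : (toDegLex (0 : Fin n →₀ ℕ)) = 0 := rfl
      rw [this, monomialIdeal_zero]
      trivial
    | add a b ha hb =>
      rw [toDegLex_add, monomialValue_add, map_mul]
      exact mul_mem_monomialIdeal ha hb
    | single i k =>
      induction k with
      | zero =>
        have : (toDegLex (Finsupp.single i 0 : Fin n →₀ ℕ)) = 0 := by
          rw [Finsupp.single_zero]; rfl
        rw [this, monomialIdeal_zero]
        trivial
      | succ k ih =>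
        rw [Finsupp.single_add, toDegLex_add, monomialValue_add, map_mul, monomialValue_single t i 1,
          pow_one]
        exact mul_mem_monomialIdeal ih (hf i)
  have : monomialIdeal t γ ≤ (monomialIdeal t γ).comap f := by
    refine Ideal.span_le.mpr ?_
    rintro _ ⟨β, hβ, rfl⟩
    exact monomialIdeal_anti hβ (key (ofDegLex β))
  exact this hx

/-- Specialization of the universal case, the ideal of the variables in a polynomial ring over `ℤ`.
-/
theorem span_range_pow (k : ℕ) :
    Ideal.span (Set.range t) ^ k =
      Ideal.span (monomialValue t '' {β | (ofDegLex β).degree = k}) := by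
  have h : (MvPolynomial.idealOfVars (Fin n) ℤ).map (MvPolynomial.aeval t).toRingHom =
      Ideal.span (Set.range t) := by
    rw [Ideal.map_span, ← Set.range_comp]
    congr 2
    ext i
    simp
  rw [← h, ← Ideal.map_pow, MvPolynomial.pow_idealOfVars_eq_span, Ideal.map_span, Set.image_image]
  congr 1
  ext x
  constructor
  · rintro ⟨β, hβ, rfl⟩
    exact ⟨toDegLex β, hβ, by simp [monomialValue, MvPolynomial.aeval_monomial]⟩
  · rintro ⟨β, hβ, rfl⟩
    exact ⟨ofDegLex β, hβ, by simp [monomialValue, MvPolynomial.aeval_monomial]⟩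

theorem span_range_pow_le {k : ℕ} {γ : DegLex (Fin n →₀ ℕ)} (h : (ofDegLex γ).degree < k) :
    Ideal.span (Set.range t) ^ k ≤ strictMonomialIdeal t γ := by
  rw [span_range_pow]
  refine Ideal.span_mono (Set.image_mono fun β hβ ↦ ?_)
  exact Finsupp.DegLex.lt_iff.mpr (Or.inl (h.trans_eq (Eq.symm hβ)))

theorem monomialIdeal_le_pow (γ : DegLex (Fin n →₀ ℕ)) :
    monomialIdeal t γ ≤ Ideal.span (Set.range t) ^ (ofDegLex γ).degree := by
  refine Ideal.span_le.mpr ?_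
  rintro _ ⟨β, hβ, rfl⟩
  refine Ideal.pow_le_pow_right (Finsupp.DegLex.monotone_degree hβ) ?_
  rw [span_range_pow]
  exact Ideal.subset_span ⟨β, rfl, rfl⟩

theorem mul_monomialValue_mem_strict {x : R} (hx : x ∈ Ideal.span (Set.range t))
    (γ : DegLex (Fin n →₀ ℕ)) : x * monomialValue t γ ∈ strictMonomialIdeal t γ := by
  have : Ideal.span (Set.range t) * Ideal.span {monomialValue t γ} ≤ strictMonomialIdeal t γ := by
    rw [Ideal.span_mul_span', Ideal.span_le]
    rintro _ ⟨_, ⟨i, rfl⟩, _, rfl, rfl⟩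
    have := monomialValue_single t i 1
    rw [pow_one] at this
    simp only [SetLike.mem_coe]
    rw [← this, ← monomialValue_add]
    refine monomialValue_mem_strict ?_
    refine Finsupp.DegLex.lt_iff.mpr (Or.inl ?_)
    rw [ofDegLex_add, map_add]
    simp
  exact this (Ideal.mul_mem_mul hx (Ideal.mem_span_singleton_self _))

/-- Each graded piece is spanned over `K` by one monomial: an element of the ideal of the parameters
pushes the monomial into the strict ideal, so coefficients matter only through their residues. -/
theorem exists_sub_smul_mem_strict {K : Type*} [Field K] [Algebra K R]
    (hres : ∀ r : R, ∃ c : K, r - algebraMap K R c ∈ Ideal.span (Set.range t))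
    {γ : DegLex (Fin n →₀ ℕ)} {x : R} (hx : x ∈ monomialIdeal t γ) :
    ∃ c : K, x - algebraMap K R c * monomialValue t γ ∈ strictMonomialIdeal t γ := by
  induction hx using Submodule.span_induction with
  | mem x h =>
    obtain ⟨β, hβ, rfl⟩ := h
    rcases (Set.mem_Ici.mp hβ).eq_or_lt with rfl | h
    · exact ⟨1, by simp⟩
    · exact ⟨0, by simpa using monomialValue_mem_strict h⟩
  | zero => exact ⟨0, by simp⟩
  | add x y _ _ hx hy =>
    obtain ⟨a, ha⟩ := hx
    obtain ⟨b, hb⟩ := hy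
    refine ⟨a + b, ?_⟩
    convert! add_mem ha hb using 1
    rw [map_add]
    ring
  | smul r x _ hx =>
    obtain ⟨a, ha⟩ := hx
    obtain ⟨b, hb⟩ := hres r
    refine ⟨b * a, ?_⟩
    convert! add_mem (Ideal.mul_mem_left _ r ha)
      (Ideal.mul_mem_left _ (algebraMap K R a) (mul_monomialValue_mem_strict hb γ)) using 1
    rw [map_mul, smul_eq_mul]
    ring

/-- By Krull's intersection theorem `x` lies outside some power of the maximal ideal. This bounds
the degrees of the exponents whose ideal contains `x`, so there is a largest one. -/
theorem exists_mem_notMem_strict [IsLocalRing R] [IsNoetherianRing R]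
    (ht : Ideal.span (Set.range t) = maximalIdeal R) {x : R} (hx : x ≠ 0) :
    ∃ γ, x ∈ monomialIdeal t γ ∧ x ∉ strictMonomialIdeal t γ := by
  obtain ⟨k, hk⟩ : ∃ k : ℕ, x ∉ maximalIdeal R ^ k := by
    by_contra! h
    have := Ideal.iInf_pow_eq_bot_of_isLocalRing (maximalIdeal R) (Ideal.IsPrime.ne_top')
    exact hx (by simpa [← Ideal.mem_bot, ← this, Ideal.mem_iInf] using h)
  let S : Set (DegLex (Fin n →₀ ℕ)) := {γ | x ∈ monomialIdeal t γ}
  have hS : S.Finite := by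
    refine Set.Finite.subset (Finsupp.finite_of_degree_lt (σ := Fin n) k) fun γ hγ ↦ ?_
    by_contra h
    refine hk (Ideal.pow_le_pow_right (not_lt.mp h) ?_)
    rw [← ht]
    exact monomialIdeal_le_pow γ hγ
  obtain ⟨γ, hγ, hmax⟩ := hS.exists_maximal ⟨0, by
    change x ∈ monomialIdeal t 0
    rw [monomialIdeal_zero]; trivial⟩
  refine ⟨γ, hγ, fun hs ↦ ?_⟩
  -- If larger exponents exist, well-ordering gives the successor of `γ`, whose ideal is the strict
  -- ideal of `γ`. Otherwise the strict ideal is zero.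
  by_cases he : (Set.Ioi γ).Nonempty
  · let δ := WellFounded.min wellFounded_lt (Set.Ioi γ) he
    have hδ : γ < δ := WellFounded.min_mem wellFounded_lt (Set.Ioi γ) he
    have hx' : δ ∈ S := by
      refine Ideal.span_mono (Set.image_mono fun β hβ ↦ ?_) hs
      exact not_lt.mp (WellFounded.not_lt_min wellFounded_lt (x := β) (Set.Ioi γ) hβ)
    exact hδ.not_ge (hmax hx' hδ.le)
  · rw [Set.not_nonempty_iff_eq_empty] at he
    rw [strictMonomialIdeal, he, Set.image_empty, Ideal.span_empty] at hs
    exact hx hs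

end MonomialFiltration


/-! ### Independence of monomials, by comparison with the polynomial ring. -/

section Independence

open IsLocalRing

variable {n : ℕ}

theorem map_monomialValue {R S : Type*} [CommRing R] [CommRing S] (f : R →+* S) (t : Fin n → R)
    (β : DegLex (Fin n →₀ ℕ)) : f (monomialValue t β) = monomialValue (fun i ↦ f (t i)) β := by
  simp [monomialValue, Finsupp.prod, map_prod]

theorem monomialValue_X {K : Type*} [Field K] (β : DegLex (Fin n →₀ ℕ)) :
    monomialValue (MvPolynomial.X : Fin n → MvPolynomial (Fin n) K) β =
      MvPolynomial.monomial (ofDegLex β) 1 := by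
  rw [MvPolynomial.monomial_eq, map_one, one_mul]
  rfl

theorem monomialValue_X_notMem_strict {K : Type*} [Field K] (γ : DegLex (Fin n →₀ ℕ)) :
    monomialValue (MvPolynomial.X : Fin n → MvPolynomial (Fin n) K) γ ∉
      strictMonomialIdeal MvPolynomial.X γ := by
  intro h
  have he : strictMonomialIdeal (MvPolynomial.X : Fin n → MvPolynomial (Fin n) K) γ =
      Ideal.span ((fun s ↦ MvPolynomial.monomial s (1 : K)) '' {β | γ < toDegLex β}) := by
    rw [strictMonomialIdeal]
    congr 1
    ext x
    constructor
    · rintro ⟨β, hβ, rfl⟩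
      exact ⟨ofDegLex β, hβ, (monomialValue_X β).symm⟩
    · rintro ⟨β, hβ, rfl⟩
      exact ⟨toDegLex β, hβ, monomialValue_X _⟩
  rw [he, monomialValue_X, MvPolynomial.mem_ideal_span_monomial_image] at h
  obtain ⟨β, hβ, hle⟩ := h (ofDegLex γ) (by classical simp)
  exact (show γ < toDegLex β from hβ).not_ge (MonomialOrder.degLex.toSyn_monotone hle)

/-- Changing parameters by terms of order two changes a monomial only in degree above its own. -/
theorem monomialValue_sub_mem {A : Type*} [CommRing A] {N : Ideal A} {s x : Fin n → A}
    (hx : ∀ i, x i ∈ N) (hs : ∀ i, s i - x i ∈ N ^ 2) (β : Fin n →₀ ℕ) :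
    monomialValue s (toDegLex β) ∈ N ^ β.degree ∧ monomialValue x (toDegLex β) ∈ N ^ β.degree ∧
      monomialValue s (toDegLex β) - monomialValue x (toDegLex β) ∈ N ^ (β.degree + 1) := by
  have hadd : ∀ a b : Fin n →₀ ℕ,
      (monomialValue s (toDegLex a) ∈ N ^ a.degree ∧ monomialValue x (toDegLex a) ∈ N ^ a.degree ∧
      monomialValue s (toDegLex a) - monomialValue x (toDegLex a) ∈ N ^ (a.degree + 1)) →
      (monomialValue s (toDegLex b) ∈ N ^ b.degree ∧ monomialValue x (toDegLex b) ∈ N ^ b.degree ∧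
      monomialValue s (toDegLex b) - monomialValue x (toDegLex b) ∈ N ^ (b.degree + 1)) →
      (monomialValue s (toDegLex (a + b)) ∈ N ^ (a + b).degree ∧
      monomialValue x (toDegLex (a + b)) ∈ N ^ (a + b).degree ∧
      monomialValue s (toDegLex (a + b)) - monomialValue x (toDegLex (a + b)) ∈
        N ^ ((a + b).degree + 1)) := by
    rintro a b ⟨ha1, ha2, ha3⟩ ⟨hb1, hb2, hb3⟩
    rw [toDegLex_add, monomialValue_add, monomialValue_add, map_add]
    refine ⟨pow_add N _ _ ▸ Ideal.mul_mem_mul ha1 hb1, pow_add N _ _ ▸ Ideal.mul_mem_mul ha2 hb2, ?_⟩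
    have h1 := Ideal.mul_mem_mul ha1 hb3
    have h2 := Ideal.mul_mem_mul ha3 hb2
    rw [← pow_add] at h1 h2
    convert! add_mem h1 (show _ ∈ N ^ (a.degree + (b.degree + 1)) by
      rwa [show a.degree + (b.degree + 1) = a.degree + 1 + b.degree by ring]) using 1
    ring
  have hzero : monomialValue s (toDegLex 0) ∈ N ^ (0 : Fin n →₀ ℕ).degree ∧
      monomialValue x (toDegLex 0) ∈ N ^ (0 : Fin n →₀ ℕ).degree ∧
      monomialValue s (toDegLex 0) - monomialValue x (toDegLex 0) ∈
        N ^ ((0 : Fin n →₀ ℕ).degree + 1) := by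
    have h : ∀ f : Fin n → A, monomialValue f (toDegLex 0) = 1 := fun f ↦ monomialValue_zero f
    simp [h]
  induction β using Finsupp.induction_linear with
  | zero => exact hzero
  | add a b ha hb => exact hadd a b ha hb
  | single i k =>
    induction k with
    | zero =>
      rw [Finsupp.single_zero]
      exact hzero
    | succ k ih =>
      rw [Finsupp.single_add]
      refine hadd _ _ ih ?_
      rw [monomialValue_single, monomialValue_single, pow_one, pow_one, Finsupp.degree_single]
      refine ⟨?_, by simpa using hx i, hs i⟩
      rw [pow_one]
      have := add_mem (hx i) (Ideal.pow_le_self two_ne_zero (hs i))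
      rwa [add_sub_cancel] at this

theorem exists_sub_linear_mem_sq {K A : Type*} [Field K] [CommRing A] [Algebra K A] {s : Fin n → A}
    (hres : ∀ a : A, ∃ c : K, a - algebraMap K A c ∈ Ideal.span (Set.range s)) (a : A) :
    ∃ (c : K) (e : Fin n → K), a - (algebraMap K A c + ∑ i, algebraMap K A (e i) * s i) ∈
      Ideal.span (Set.range s) ^ 2 := by
  have key : ∀ x ∈ Ideal.span (Set.range s), ∃ e : Fin n → K,
      x - ∑ i, algebraMap K A (e i) * s i ∈ Ideal.span (Set.range s) ^ 2 := by
    intro x hx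
    induction hx using Submodule.span_induction with
    | mem x h =>
      obtain ⟨i, rfl⟩ := h
      classical
      refine ⟨Pi.single i 1, ?_⟩
      rw [Finset.sum_eq_single i (fun j _ hj ↦ by simp [hj]) (by simp)]
      simp
    | zero => exact ⟨0, by simp⟩
    | add x y _ _ hx hy =>
      obtain ⟨a, ha⟩ := hx
      obtain ⟨b, hb⟩ := hy
      refine ⟨a + b, ?_⟩
      convert! add_mem ha hb using 1
      simp only [Pi.add_apply, map_add, add_mul, Finset.sum_add_distrib]
      ring
    | smul r x hx' hx =>
      obtain ⟨a, ha⟩ := hx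
      obtain ⟨b, hb⟩ := hres r
      refine ⟨b • a, ?_⟩
      convert! add_mem (Ideal.mul_mem_left _ (algebraMap K A b) ha)
        (sq (Ideal.span (Set.range s)) ▸ Ideal.mul_mem_mul hb hx') using 1
      simp only [Pi.smul_apply, smul_eq_mul, map_mul, mul_assoc, ← Finset.mul_sum]
      ring
  obtain ⟨c, hc⟩ := hres a
  obtain ⟨e, he⟩ := key _ hc
  exact ⟨c, e, by rwa [← sub_sub]⟩

/-- Monomials in a regular system of parameters of a local ring that is formally smooth over its
residue field are independent. -/
theorem monomialValue_notMem_strict {K R : Type*} [Field K] [CommRing R] [IsLocalRing R]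
    [Algebra K R] [Algebra.FormallySmooth K R] {t : Fin n → R}
    (ht : Ideal.span (Set.range t) = maximalIdeal R)
    (hres : ∀ r : R, ∃ c : K, r - algebraMap K R c ∈ maximalIdeal R)
    (hind : ∀ e : Fin n → K, ∑ i, algebraMap K R (e i) * t i ∈ maximalIdeal R ^ 2 → e = 0)
    (γ : DegLex (Fin n →₀ ℕ)) : monomialValue t γ ∉ strictMonomialIdeal t γ := by
  let d := (ofDegLex γ).degree
  let 𝔐 := MvPolynomial.idealOfVars (Fin n) K
  have h𝔐 : Ideal.span (Set.range (MvPolynomial.X : Fin n → MvPolynomial (Fin n) K)) = 𝔐 := rfl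
  have hresP : ∀ p : MvPolynomial (Fin n) K,
      ∃ c : K, p - algebraMap K (MvPolynomial (Fin n) K) c ∈ 𝔐 := fun p ↦ by
    refine ⟨p.coeff 0, ?_⟩
    rw [← pow_one 𝔐]
    refine (MvPolynomial.mem_pow_idealOfVars_iff' _ _).mpr fun x hx ↦ ?_
    have : x = 0 := (Finsupp.degree_eq_zero_iff x).mp (by omega)
    rw [this, MvPolynomial.algebraMap_eq, MvPolynomial.coeff_sub, MvPolynomial.coeff_zero_C,
      sub_self]
  have hmap : 𝔐 ≤ (maximalIdeal R).comap (MvPolynomial.aeval (R := K) t).toRingHom := by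
    refine Ideal.span_le.mpr ?_
    rintro _ ⟨i, rfl⟩
    change MvPolynomial.aeval t (MvPolynomial.X i) ∈ maximalIdeal R
    rw [MvPolynomial.aeval_X, ← ht]
    exact Ideal.subset_span ⟨i, rfl⟩
  have hmapk : ∀ k, ∀ p ∈ 𝔐 ^ k, MvPolynomial.aeval t p ∈ maximalIdeal R ^ k := fun k p hp ↦
    (Ideal.pow_right_mono hmap k).trans (Ideal.le_comap_pow _ k) hp
  let g₀ : MvPolynomial (Fin n) K →ₐ[K] R ⧸ maximalIdeal R ^ 2 :=
    (Ideal.Quotient.mkₐ K _).comp (MvPolynomial.aeval t)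
  -- The exponent `d + 2` is at least two even if `d = 0`, so `g` is well defined. It is surjective
  -- with nilpotent kernel, so formal smoothness lifts the projection of `R` to a map `ψ` into
  -- truncated polynomials sending `t i` to `X i` up to order two.
  let g : (MvPolynomial (Fin n) K ⧸ 𝔐 ^ (d + 2)) →ₐ[K] R ⧸ maximalIdeal R ^ 2 :=
    Ideal.Quotient.liftₐ _ g₀ fun p hp ↦
      Ideal.Quotient.eq_zero_iff_mem.mpr (Ideal.pow_le_pow_right (by omega) (hmapk _ _ hp))
  have hgmk : ∀ p, g (Ideal.Quotient.mk _ p) = Ideal.Quotient.mk _ (MvPolynomial.aeval t p) :=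
    fun p ↦ rfl
  have hg : Function.Surjective g := by
    intro y
    obtain ⟨r, rfl⟩ := Ideal.Quotient.mk_surjective y
    obtain ⟨c, e, hce⟩ := exists_sub_linear_mem_sq (K := K) (s := t) (by rwa [ht]) r
    refine ⟨Ideal.Quotient.mk _ (MvPolynomial.C c + ∑ i, MvPolynomial.C (e i) * MvPolynomial.X i), ?_⟩
    rw [hgmk, eq_comm, Ideal.Quotient.eq, ← ht]
    simpa using hce
  have hker : ∀ p, MvPolynomial.aeval t p ∈ maximalIdeal R ^ 2 → p ∈ 𝔐 ^ 2 := by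
    intro p hp
    obtain ⟨c, e, hce⟩ := exists_sub_linear_mem_sq (K := K) (s := MvPolynomial.X) hresP p
    have h1 := hmapk 2 _ hce
    simp only [map_sub, map_add, map_sum, map_mul, MvPolynomial.aeval_X, AlgHom.commutes] at h1
    have h2 : algebraMap K R c + ∑ i, algebraMap K R (e i) * t i ∈ maximalIdeal R ^ 2 := by
      have := sub_mem hp h1
      rwa [sub_sub_cancel] at this
    have h3 : ∑ i, algebraMap K R (e i) * t i ∈ maximalIdeal R :=
      Ideal.sum_mem _ fun i _ ↦ Ideal.mul_mem_left _ _ (ht ▸ Ideal.subset_span ⟨i, rfl⟩)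
    have hc : c = 0 := by
      by_contra hc
      have h4 := sub_mem (Ideal.pow_le_self two_ne_zero h2) h3
      rw [add_sub_cancel_right] at h4
      exact (mem_maximalIdeal _).mp h4 ((IsUnit.mk0 c hc).map (algebraMap K R))
    rw [hc, map_zero, zero_add] at h2
    rw [hc, hind e h2] at hce
    simpa using hce
  have hnil : IsNilpotent (RingHom.ker g) := by
    refine ⟨d + 2, ?_⟩
    rw [Ideal.zero_eq_bot, eq_bot_iff]
    have h1 : RingHom.ker g ≤
        𝔐.map (Ideal.Quotient.mk (𝔐 ^ (d + 2))) := by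
      intro y hy
      obtain ⟨p, rfl⟩ := Ideal.Quotient.mk_surjective y
      exact Ideal.mem_map_of_mem _ (Ideal.pow_le_self two_ne_zero
        (hker p (Ideal.Quotient.eq_zero_iff_mem.mp hy)))
    refine (Ideal.pow_right_mono h1 _).trans ?_
    rw [← Ideal.map_pow, Ideal.map_quotient_self]
  let ψ := Algebra.FormallySmooth.liftOfSurjective
    (Ideal.Quotient.mkₐ K (maximalIdeal R ^ 2)) g hg hnil
  have hψ : ∀ x, g (ψ x) = Ideal.Quotient.mk _ x :=
    Algebra.FormallySmooth.liftOfSurjective_apply _ g hg hnil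
  let J := strictMonomialIdeal (MvPolynomial.X : Fin n → MvPolynomial (Fin n) K) γ
  have hJ1 : 𝔐 ^ (d + 1) ≤ J := span_range_pow_le (Nat.lt_succ_self _)
  have hJ2 : 𝔐 ^ (d + 2) ≤ J := (Ideal.pow_le_pow_right (by omega)).trans hJ1
  let π := Ideal.Quotient.mk J
  let θ : R →+* MvPolynomial (Fin n) K ⧸ J :=
    (Ideal.Quotient.factor hJ2).comp ψ.toRingHom
  have hθ : ∀ i, θ (t i) - π (MvPolynomial.X i) ∈ 𝔐.map π ^ 2 := by
    intro i
    obtain ⟨p, hp⟩ := Ideal.Quotient.mk_surjective (ψ (t i))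
    have h1 := hψ (t i)
    rw [← hp, hgmk, Ideal.Quotient.eq] at h1
    have h2 := hker (p - MvPolynomial.X i) (by simpa using h1)
    have h3 : θ (t i) = π p := by
      change Ideal.Quotient.factor hJ2 (ψ (t i)) = _
      rw [← hp]
      rfl
    rw [h3, ← map_sub, ← Ideal.map_pow]
    exact Ideal.mem_map_of_mem _ h2
  have hN : 𝔐.map π ^ (d + 1) = ⊥ := by
    rw [← Ideal.map_pow, eq_bot_iff]
    exact (Ideal.map_mono hJ1).trans (Ideal.map_quotient_self J).le
  -- Modulo `J` everything of degree above `d` vanishes, so for these `β` the error terms of `θ`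
  -- vanish and a relation among monomials in `t` becomes one in the polynomial ring.
  have hval : ∀ β : DegLex (Fin n →₀ ℕ), γ ≤ β →
      θ (monomialValue t β) = π (monomialValue MvPolynomial.X β) := by
    intro β hβ
    rw [map_monomialValue, map_monomialValue, ← sub_eq_zero, ← Ideal.mem_bot, ← hN]
    exact Ideal.pow_le_pow_right (Nat.succ_le_succ (Finsupp.DegLex.monotone_degree hβ))
      (monomialValue_sub_mem
        (fun i ↦ Ideal.mem_map_of_mem π (Ideal.subset_span (Set.mem_range_self i))) hθ
        (ofDegLex β)).2.2
  intro hmem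
  have hle : strictMonomialIdeal t γ ≤ RingHom.ker θ := by
    refine Ideal.span_le.mpr ?_
    rintro _ ⟨β, hβ, rfl⟩
    change θ _ = 0
    rw [hval β (le_of_lt hβ)]
    exact Ideal.Quotient.eq_zero_iff_mem.mpr (monomialValue_mem_strict hβ)
  have h0 : θ (monomialValue t γ) = 0 := hle hmem
  rw [hval γ le_rfl] at h0
  exact monomialValue_X_notMem_strict γ (Ideal.Quotient.eq_zero_iff_mem.mp h0)

end Independence


/-! ### The valuation ring of a monoid-valued valuation. -/

section FractionValuation

variable {R F Γ : Type*} [CommRing R] [Field F] [Algebra R F] [IsFractionRing R F]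
  [AddCancelCommMonoid Γ] [LinearOrder Γ] [IsOrderedAddMonoid Γ]

/-- The values form only a cancellative monoid, so fractions are tested by comparing numerator and
denominator; this shows independence of the representation. -/
theorem valuation_le_of_div_eq [IsDomain R] (v : AddValuation R (WithTop Γ))
    (hv : ∀ x, v x = ⊤ → x = 0) {a b a' b' : R} (hb : b ≠ 0) (hb' : b' ≠ 0)
    (h : algebraMap R F a / algebraMap R F b = algebraMap R F a' / algebraMap R F b')
    (hle : v b ≤ v a) : v b' ≤ v a' := by
  have hinj := IsFractionRing.injective R F
  rw [div_eq_div_iff ((map_ne_zero_iff _ hinj).mpr hb) ((map_ne_zero_iff _ hinj).mpr hb'),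
    ← map_mul, ← map_mul] at h
  have h1 := congr_arg v (hinj h)
  rw [v.map_mul, v.map_mul] at h1
  have h2 : v b' + v b ≤ v a' + v b := by
    rw [← h1, add_comm (v a)]
    gcongr
  exact (WithTop.add_le_add_iff_right fun h ↦ hb (hv b h)).mp h2

/-- The valuation ring, in the field of fractions of a domain, of a valuation on the domain. -/
noncomputable def fractionValuationSubring [IsDomain R] (F : Type*) [Field F] [Algebra R F]
    [IsFractionRing R F] (v : AddValuation R (WithTop Γ)) : ValuationSubring F where
  carrier := {x | ∃ a b, b ≠ 0 ∧ v b ≤ v a ∧ algebraMap R F a / algebraMap R F b = x}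
  mul_mem' := by
    rintro _ _ ⟨a, b, hb, hab, rfl⟩ ⟨c, d, hd, hcd, rfl⟩
    refine ⟨a * c, b * d, mul_ne_zero hb hd, ?_, ?_⟩
    · rw [v.map_mul, v.map_mul]
      gcongr
    · rw [map_mul, map_mul, div_mul_div_comm]
  one_mem' := ⟨1, 1, one_ne_zero, le_rfl, by simp⟩
  add_mem' := by
    rintro _ _ ⟨a, b, hb, hab, rfl⟩ ⟨c, d, hd, hcd, rfl⟩
    have hinj := IsFractionRing.injective R F
    refine ⟨a * d + b * c, b * d, mul_ne_zero hb hd, ?_, ?_⟩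
    · refine le_trans (le_min ?_ ?_) (v.map_add _ _)
      · rw [v.map_mul, v.map_mul]
        gcongr
      · rw [v.map_mul, v.map_mul]
        gcongr
    · rw [map_add, map_mul, map_mul, map_mul, div_add_div _ _ ((map_ne_zero_iff _ hinj).mpr hb)
        ((map_ne_zero_iff _ hinj).mpr hd)]
  zero_mem' := ⟨0, 1, one_ne_zero, by simp, by simp⟩
  neg_mem' := by
    rintro _ ⟨a, b, hb, hab, rfl⟩
    exact ⟨-a, b, hb, by rwa [v.map_neg], by rw [map_neg, neg_div]⟩
  mem_or_inv_mem' x := by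
    obtain ⟨a, b, hb, rfl⟩ := IsFractionRing.div_surjective (A := R) x
    have hb := nonZeroDivisors.ne_zero hb
    by_cases ha : a = 0
    · exact Or.inl ⟨0, 1, one_ne_zero, by simp, by simp [ha]⟩
    rcases le_total (v b) (v a) with h | h
    · exact Or.inl ⟨a, b, hb, h, rfl⟩
    · exact Or.inr ⟨b, a, ha, h, (inv_div _ _).symm⟩

theorem div_mem_fractionValuationSubring_iff [IsDomain R] {v : AddValuation R (WithTop Γ)}
    (hv : ∀ x, v x = ⊤ → x = 0) {a b : R} (hb : b ≠ 0) :
    algebraMap R F a / algebraMap R F b ∈ fractionValuationSubring F v ↔ v b ≤ v a :=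
  ⟨fun ⟨_, _, hd, hcd, h⟩ ↦ valuation_le_of_div_eq v hv hd hb h hcd, fun h ↦ ⟨a, b, hb, h, rfl⟩⟩

end FractionValuation

noncomputable instance (n : ℕ) : AddCancelCommMonoid (DegLex (Fin n →₀ ℕ)) where
  add_left_cancel a _ _ h := _root_.add_left_cancel (a := (ofDegLex a : Fin n →₀ ℕ)) h

/-! ### The leading-exponent valuation. -/

section MonomialValuation

open IsLocalRing

variable {n : ℕ} {K R : Type*} [Field K] [CommRing R]

/-- A family generating the maximal ideal of a local `K`-algebra with residue field `K`, in which
every monomial is independent of the larger ones in the degree-lexicographic order. -/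
structure IsMonomialSystem (K : Type*) {R : Type*} [Field K] [CommRing R] [IsLocalRing R]
    [Algebra K R] (t : Fin n → R) : Prop where
  span_eq : Ideal.span (Set.range t) = maximalIdeal R
  residue : ∀ r : R, ∃ c : K, r - algebraMap K R c ∈ maximalIdeal R
  independent : ∀ γ, monomialValue t γ ∉ strictMonomialIdeal t γ

/-- `γ` is the smallest exponent of a monomial in the expansion of `x` in `t`. -/
def HasLeadingExponent (t : Fin n → R) (x : R) (γ : DegLex (Fin n →₀ ℕ)) : Prop :=
  x ∈ monomialIdeal t γ ∧ x ∉ strictMonomialIdeal t γ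

variable {t : Fin n → R}

theorem HasLeadingExponent.mem_iff {x : R} {γ : DegLex (Fin n →₀ ℕ)}
    (h : HasLeadingExponent t x γ) (δ : DegLex (Fin n →₀ ℕ)) :
    x ∈ monomialIdeal t δ ↔ δ ≤ γ :=
  ⟨fun hx ↦ not_lt.mp fun hlt ↦ h.2 (monomialIdeal_le_strict hlt hx),
    fun hle ↦ monomialIdeal_anti hle h.1⟩

theorem HasLeadingExponent.eq {x : R} {γ δ : DegLex (Fin n →₀ ℕ)}
    (h : HasLeadingExponent t x γ) (h' : HasLeadingExponent t x δ) : γ = δ :=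
  le_antisymm ((h'.mem_iff γ).mp h.1) ((h.mem_iff δ).mp h'.1)

namespace IsMonomialSystem

variable [IsLocalRing R] [Algebra K R]

variable (ht : IsMonomialSystem K t)
include ht

/-- Leading coefficients are nonzero elements of the field `K`, so their product is nonzero, and
independence keeps the product monomial out of the strict ideal. -/
theorem leading_mul {x y : R} {γ δ : DegLex (Fin n →₀ ℕ)} (hx : HasLeadingExponent t x γ)
    (hy : HasLeadingExponent t y δ) : HasLeadingExponent t (x * y) (γ + δ) := by
  refine ⟨mul_mem_monomialIdeal hx.1 hy.1, fun hxy ↦ ?_⟩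
  have hres := ht.residue
  rw [← ht.span_eq] at hres
  obtain ⟨a, ha⟩ := exists_sub_smul_mem_strict (K := K) hres hx.1
  obtain ⟨b, hb⟩ := exists_sub_smul_mem_strict (K := K) hres hy.1
  have ha0 : a ≠ 0 := by
    rintro rfl
    exact hx.2 (by simpa using ha)
  have hb0 : b ≠ 0 := by
    rintro rfl
    exact hy.2 (by simpa using hb)
  have h1 := mul_mem_strictMonomialIdeal hx.1 hb
  have h2 := mul_mem_strictMonomialIdeal
    (Ideal.mul_mem_left _ (algebraMap K R b) (monomialValue_mem (t := t) (le_refl δ))) ha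
  rw [add_comm δ γ] at h2
  have h3 : algebraMap K R (a * b) * monomialValue t (γ + δ) ∈ strictMonomialIdeal t (γ + δ) := by
    convert! sub_mem hxy (add_mem h1 h2) using 1
    rw [monomialValue_add, map_mul]
    ring
  have h4 := Ideal.mul_mem_left _ (algebraMap K R (a * b)⁻¹) h3
  rw [← mul_assoc, ← map_mul, inv_mul_cancel₀ (mul_ne_zero ha0 hb0), map_one, one_mul] at h4
  exact ht.independent _ h4

variable [IsNoetherianRing R]

theorem exists_leading {x : R} (hx : x ≠ 0) : ∃ γ, HasLeadingExponent t x γ :=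
  exists_mem_notMem_strict ht.span_eq hx

theorem isDomain : IsDomain R := by
  have : NoZeroDivisors R := ⟨fun {x y} hxy ↦ by
    by_contra! h
    obtain ⟨γ, hγ⟩ := ht.exists_leading h.1
    obtain ⟨δ, hδ⟩ := ht.exists_leading h.2
    exact (ht.leading_mul hγ hδ).2 (hxy ▸ zero_mem _)⟩
  exact NoZeroDivisors.to_isDomain R

/-- The valuation sending an element to its leading exponent. -/
noncomputable def valuation : AddValuation R (WithTop (DegLex (Fin n →₀ ℕ))) := by
  classical
  exact AddValuation.of (fun x ↦ if hx : x = 0 then ⊤ else ((ht.exists_leading hx).choose : WithTop _))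
    (by simp)
    (by
      have := ht.isDomain
      rw [dif_neg one_ne_zero]
      have h1 := (ht.exists_leading (one_ne_zero (α := R))).choose_spec
      have h2 : HasLeadingExponent t (1 : R) 0 :=
        monomialValue_zero t ▸ ⟨monomialValue_mem le_rfl, ht.independent 0⟩
      exact congr_arg _ (h1.eq h2))
    (fun x y ↦ by
      by_cases hx : x = 0
      · simp [hx]
      by_cases hy : y = 0
      · simp [hy]
      by_cases hxy : x + y = 0
      · simp [hxy]
      rw [dif_neg hx, dif_neg hy, dif_neg hxy]
      have h4 := (ht.exists_leading hxy).choose_spec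
      have h1 := ht.exists_leading hx
      have h2 := ht.exists_leading hy
      change min (h1.choose : WithTop (DegLex (Fin n →₀ ℕ))) h2.choose ≤ _
      rcases le_total h1.choose h2.choose with h | h
      · rw [min_eq_left (WithTop.coe_le_coe.mpr h), WithTop.coe_le_coe]
        exact (h4.mem_iff _).mp (add_mem h1.choose_spec.1 (monomialIdeal_anti h h2.choose_spec.1))
      · rw [min_eq_right (WithTop.coe_le_coe.mpr h), WithTop.coe_le_coe]
        exact (h4.mem_iff _).mp (add_mem (monomialIdeal_anti h h1.choose_spec.1) h2.choose_spec.1))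
    (fun x y ↦ by
      have := ht.isDomain
      by_cases hx : x = 0
      · simp [hx]
      by_cases hy : y = 0
      · simp [hy]
      rw [dif_neg hx, dif_neg hy, dif_neg (mul_ne_zero hx hy), ← WithTop.coe_add, WithTop.coe_inj]
      generalize_proofs h1 h2 h3
      exact h1.choose_spec.eq (ht.leading_mul h2.choose_spec h3.choose_spec))

theorem valuation_eq_coe {x : R} {γ : DegLex (Fin n →₀ ℕ)} (h : HasLeadingExponent t x γ) :
    ht.valuation x = γ := by
  have hx : x ≠ 0 := by
    rintro rfl
    exact h.2 (zero_mem _)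
  have h1 : ht.valuation x = ((ht.exists_leading hx).choose : WithTop _) := dif_neg hx
  rw [h1, (ht.exists_leading hx).choose_spec.eq h]

theorem valuation_eq_top_iff {x : R} : ht.valuation x = ⊤ ↔ x = 0 := by
  refine ⟨fun h ↦ ?_, fun h ↦ h ▸ ht.valuation.map_zero⟩
  by_contra hx
  obtain ⟨γ, hγ⟩ := ht.exists_leading hx
  rw [ht.valuation_eq_coe hγ] at h
  exact WithTop.coe_ne_top h

theorem coe_le_valuation_iff {x : R} {γ : DegLex (Fin n →₀ ℕ)} :
    γ ≤ ht.valuation x ↔ x ∈ monomialIdeal t γ := by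
  by_cases hx : x = 0
  · simp [hx]
  · obtain ⟨δ, hδ⟩ := ht.exists_leading hx
    rw [ht.valuation_eq_coe hδ, WithTop.coe_le_coe, hδ.mem_iff]

/-- Two nonzero elements of equal valuation differ by a scalar up to higher valuation. -/
theorem exists_valuation_lt {x y : R} (hy : y ≠ 0) (hxy : ht.valuation y ≤ ht.valuation x) :
    ∃ c : K, ht.valuation y < ht.valuation (x - algebraMap K R c * y) := by
  have hres := ht.residue
  rw [← ht.span_eq] at hres
  obtain ⟨γ, hγ⟩ := ht.exists_leading hy
  rw [ht.valuation_eq_coe hγ] at hxy ⊢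
  obtain ⟨a, ha⟩ := exists_sub_smul_mem_strict (K := K) hres (ht.coe_le_valuation_iff.mp hxy)
  obtain ⟨b, hb⟩ := exists_sub_smul_mem_strict (K := K) hres hγ.1
  have hb0 : b ≠ 0 := by
    rintro rfl
    exact hγ.2 (by simpa using hb)
  refine ⟨a / b, ?_⟩
  have h1 : x - algebraMap K R (a / b) * y ∈ strictMonomialIdeal t γ := by
    convert! sub_mem ha (Ideal.mul_mem_left _ (algebraMap K R (a / b)) hb) using 1
    rw [mul_sub, ← mul_assoc, ← map_mul, div_mul_cancel₀ a hb0]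
    ring
  by_cases h0 : x - algebraMap K R (a / b) * y = 0
  · rw [h0, ht.valuation.map_zero]
    exact WithTop.coe_lt_top γ
  · obtain ⟨δ, hδ⟩ := ht.exists_leading h0
    rw [ht.valuation_eq_coe hδ, WithTop.coe_lt_coe]
    refine lt_of_le_of_ne ((hδ.mem_iff γ).mp (strictMonomialIdeal_le γ h1)) ?_
    rintro rfl
    exact hδ.2 h1

theorem valuation_map (f : R ≃+* R)
    (hf : ∀ i, f (t i) ∈ monomialIdeal t (toDegLex (Finsupp.single i 1)))
    (hf' : ∀ i, f.symm (t i) ∈ monomialIdeal t (toDegLex (Finsupp.single i 1))) (x : R) :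
    ht.valuation (f x) = ht.valuation x := by
  have key : ∀ γ, f x ∈ monomialIdeal t γ ↔ x ∈ monomialIdeal t γ := fun γ ↦
    ⟨fun h ↦ by simpa using map_mem_monomialIdeal f.symm.toRingHom hf' h,
      fun h ↦ map_mem_monomialIdeal f.toRingHom hf h⟩
  by_cases hx : x = 0
  · simp [hx]
  · obtain ⟨γ, hγ⟩ := ht.exists_leading hx
    obtain ⟨δ, hδ⟩ := ht.exists_leading ((map_ne_zero_iff f f.injective).mpr hx)
    rw [ht.valuation_eq_coe hγ, ht.valuation_eq_coe hδ, WithTop.coe_inj]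
    exact le_antisymm ((hγ.mem_iff δ).mp ((key δ).mp hδ.1)) ((hδ.mem_iff γ).mp ((key γ).mpr hγ.1))

end IsMonomialSystem

end MonomialValuation


/-! ### Parameters adapted to a group action, and the invariant valuation ring. -/

section RegularValuation

open IsLocalRing

variable {K R : Type*} [Field K] [CommRing R] [IsLocalRing R] [Algebra K R]

theorem finite_of_smul_eq {K R V : Type*} [Field K] [CommRing R] [Algebra K R] [AddCommGroup V]
    [Module R V] [Module K V] [IsScalarTower K R V] [Module.Finite R V]
    (h : ∀ r : R, ∃ c : K, ∀ v : V, r • v = c • v) : Module.Finite K V := by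
  obtain ⟨s, hs⟩ := Module.Finite.fg_top (R := R) (M := V)
  refine ⟨⟨s, ?_⟩⟩
  rw [eq_top_iff]
  intro v _
  have hv : v ∈ Submodule.span R (s : Set V) := hs ▸ trivial
  induction hv using Submodule.span_induction with
  | mem x hx => exact Submodule.subset_span hx
  | zero => exact zero_mem _
  | add x y _ _ hx hy => exact add_mem (hx trivial) (hy trivial)
  | smul r x _ hx =>
    obtain ⟨c, hc⟩ := h r
    rw [hc]
    exact Submodule.smul_mem _ _ (hx trivial)

theorem smul_cotangent_eq (hres : ∀ r : R, ∃ c : K, r - algebraMap K R c ∈ maximalIdeal R) (r : R) :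
    ∃ c : K, ∀ v : (maximalIdeal R).Cotangent, r • v = c • v := by
  obtain ⟨c, hc⟩ := hres r
  refine ⟨c, fun v ↦ ?_⟩
  obtain ⟨x, rfl⟩ := Ideal.toCotangent_surjective _ v
  rw [← algebraMap_smul R c, ← sub_eq_zero, ← sub_smul, ← map_smul, Ideal.toCotangent_eq_zero, sq]
  exact Ideal.mul_mem_mul hc x.2

theorem maximalIdeal_le_comap_algEquiv (e : R ≃ₐ[K] R) :
    maximalIdeal R ≤ (maximalIdeal R).comap (e : R →ₐ[K] R) := fun x hx ↦ by
  rw [Ideal.mem_comap, mem_maximalIdeal]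
  exact fun hu ↦ (mem_maximalIdeal x).mp hx ((MulEquiv.isUnit_map e).mp hu)

/-- The action of a local automorphism on the cotangent space. -/
noncomputable def cotangentAction {H : Type*} [Monoid H] (α : H →* (R ≃ₐ[K] R)) :
    H →* Module.End K (maximalIdeal R).Cotangent where
  toFun h := Ideal.mapCotangent _ _ (α h : R →ₐ[K] R) (maximalIdeal_le_comap_algEquiv (α h))
  map_one' := by
    ext v
    obtain ⟨x, rfl⟩ := Ideal.toCotangent_surjective _ v
    refine (Ideal.mapCotangent_toCotangent _ _ _ _ x).trans ?_
    rw [Module.End.one_apply]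
    refine congr_arg _ (Subtype.ext ?_)
    simp
  map_mul' a b := by
    ext v
    obtain ⟨x, rfl⟩ := Ideal.toCotangent_surjective _ v
    refine (Ideal.mapCotangent_toCotangent _ _ _ _ x).trans ?_
    rw [Module.End.mul_apply]
    refine Eq.trans ?_ (congr_arg _ (Ideal.mapCotangent_toCotangent _ _ _ _ x).symm)
    refine Eq.trans ?_ (Ideal.mapCotangent_toCotangent _ _ _ _ _).symm
    refine congr_arg _ (Subtype.ext ?_)
    simp

/-- Degree is compared first, so the square of the maximal ideal lies in every degree-one monomial
ideal, and membership depends only on the cotangent class. -/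
theorem mem_monomialIdeal_of_toCotangent_mem_span {n : ℕ} {t : Fin n → maximalIdeal R}
    (hspan : Ideal.span (Set.range fun j ↦ (t j : R)) = maximalIdeal R) (i : Fin n)
    {y : (maximalIdeal R).Cotangent}
    (hy : y ∈ Submodule.span K ((fun j ↦ (maximalIdeal R).toCotangent (t j)) '' {j | j ≤ i}))
    (x : maximalIdeal R) (hx : (maximalIdeal R).toCotangent x = y) :
    (x : R) ∈ monomialIdeal (fun j ↦ (t j : R)) (toDegLex (Finsupp.single i 1)) := by
  have hle2 : maximalIdeal R ^ 2 ≤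
      monomialIdeal (fun j ↦ (t j : R)) (toDegLex (Finsupp.single i 1)) := by
    refine (congr_arg (· ^ 2) hspan).symm.le.trans ?_
    exact (span_range_pow_le (by simp)).trans (strictMonomialIdeal_le _)
  induction hy using Submodule.span_induction generalizing x with
  | mem y hy =>
    obtain ⟨j, hj, rfl⟩ := hy
    have h1 : (t j : R) ∈ monomialIdeal (fun j ↦ (t j : R)) (toDegLex (Finsupp.single i 1)) := by
      have := monomialValue_mem (t := fun j ↦ (t j : R)) (Finsupp.DegLex.single_le_iff.mpr hj)
      rwa [monomialValue_single, pow_one] at this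
    have := add_mem (hle2 ((Ideal.toCotangent_eq _).mp hx)) h1
    rwa [sub_add_cancel] at this
  | zero => exact hle2 ((Ideal.toCotangent_eq_zero _ _).mp hx)
  | add y z _ _ hy hz =>
    obtain ⟨y', rfl⟩ := Ideal.toCotangent_surjective _ y
    obtain ⟨z', rfl⟩ := Ideal.toCotangent_surjective _ z
    rw [← map_add, Ideal.toCotangent_eq] at hx
    have := add_mem (hle2 hx) (add_mem (hy y' rfl) (hz z' rfl))
    rwa [Submodule.coe_add, sub_add_cancel] at this
  | smul c y _ hy =>
    obtain ⟨y', rfl⟩ := Ideal.toCotangent_surjective _ y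
    have h1 : c • (maximalIdeal R).toCotangent y' =
        (maximalIdeal R).toCotangent (algebraMap K R c • y') := by
      rw [LinearMap.map_smul, algebraMap_smul]
    rw [h1, Ideal.toCotangent_eq] at hx
    have := add_mem (hle2 hx) (Ideal.mul_mem_left _ (algebraMap K R c) (hy y' rfl))
    rwa [Submodule.coe_smul, smul_eq_mul, sub_add_cancel] at this

/-- Lift a triangular basis of the cotangent space: Nakayama's lemma gives generation, linear
independence the independence of monomials, and triangularity the compatibility with the action. -/
theorem exists_isMonomialSystem [IsAlgClosed K] [IsNoetherianRing R] [Algebra.FormallySmooth K R]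
    (hres : ∀ r : R, ∃ c : K, r - algebraMap K R c ∈ maximalIdeal R)
    {H : Type*} [CommGroup H] (α : H →* (R ≃ₐ[K] R)) :
    ∃ (n : ℕ) (t : Fin n → R), IsMonomialSystem K t ∧
      ∀ h i, α h (t i) ∈ monomialIdeal t (toDegLex (Finsupp.single i 1)) := by
  have : Module.Finite R (maximalIdeal R).Cotangent :=
    Module.Finite.of_surjective _ (Ideal.toCotangent_surjective (maximalIdeal R))
  have hfin : Module.Finite K (maximalIdeal R).Cotangent := finite_of_smul_eq (smul_cotangent_eq hres)
  obtain ⟨b, hb⟩ := exists_lower_triangular_basis (cotangentAction α)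
  choose t' ht' using fun i ↦ Ideal.toCotangent_surjective _ (b i)
  let t : Fin (Module.finrank K (maximalIdeal R).Cotangent) → R := fun i ↦ t' i
  have hspan : Ideal.span (Set.range t) = maximalIdeal R := by
    have h1 : Submodule.span R (Set.range t') = ⊤ := by
      rw [← CotangentSpace.map_eq_top_iff, Submodule.map_span, ← Set.range_comp, eq_top_iff]
      intro v _
      have hv : v ∈ Submodule.span K (Set.range b) := b.span_eq ▸ trivial
      have hrange : Set.range ((maximalIdeal R).toCotangent ∘ t') = Set.range b :=
        congr_arg Set.range (funext ht')
      rw [hrange]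
      exact Submodule.span_le_restrictScalars K R _ hv
    have h2 : Set.range t = Subtype.val '' Set.range t' := by
      rw [← Set.range_comp]; rfl
    rw [h2, Ideal.span]
    have := congr_arg (Submodule.map (maximalIdeal R).subtype) h1
    rw [Submodule.map_span, Submodule.map_top, Submodule.range_subtype] at this
    exact this
  have hmk : ∀ e : Fin _ → K, ∃ h : ∑ i, algebraMap K R (e i) * t i ∈ maximalIdeal R,
      (maximalIdeal R).toCotangent ⟨_, h⟩ = ∑ i, e i • b i := by
    intro e
    refine ⟨Ideal.sum_mem _ fun i _ ↦ Ideal.mul_mem_left _ _ (t' i).2, ?_⟩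
    rw [show (⟨∑ i, algebraMap K R (e i) * t i, _⟩ : maximalIdeal R) =
      ∑ i, algebraMap K R (e i) • t' i by ext; simp [t, Algebra.smul_def], map_sum]
    refine Finset.sum_congr rfl fun i _ ↦ ?_
    rw [LinearMap.map_smul, ht', algebraMap_smul]
  have hind : ∀ e : Fin _ → K, ∑ i, algebraMap K R (e i) * t i ∈ maximalIdeal R ^ 2 → e = 0 := by
    intro e he
    obtain ⟨h, h'⟩ := hmk e
    rw [(Ideal.toCotangent_eq_zero _ _).mpr he] at h'
    exact funext (Fintype.linearIndependent_iff.mp b.linearIndependent e h'.symm)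
  have hindep := monomialValue_notMem_strict hspan hres hind
  refine ⟨_, t, ⟨hspan, hres, hindep⟩, fun h i ↦ ?_⟩
  have h1 : α h (t i) ∈ maximalIdeal R := maximalIdeal_le_comap_algEquiv (α h) (t' i).2
  have hb' := hb h i
  rw [show (b : Fin _ → _) = fun j ↦ (maximalIdeal R).toCotangent (t' j) from (funext ht').symm]
    at hb'
  refine mem_monomialIdeal_of_toCotangent_mem_span hspan i hb' ⟨_, h1⟩ ?_
  exact (Ideal.mapCotangent_toCotangent _ _ _ (maximalIdeal_le_comap_algEquiv (α h)) (t' i)).symm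

/-- A commutative group acting on a local ring that is formally smooth over its algebraically closed
residue field preserves a valuation ring of the field of fractions with the same residue field. -/
theorem exists_invariant_valuationSubring_of_formallySmooth [IsAlgClosed K] [IsNoetherianRing R]
    [Algebra.FormallySmooth K R] (hres : ∀ r : R, ∃ c : K, r - algebraMap K R c ∈ maximalIdeal R)
    {H : Type*} [CommGroup H] (α : H →* (R ≃ₐ[K] R)) (F : Type*) [Field F] [Algebra R F]
    [IsFractionRing R F] :
    ∃ V : ValuationSubring F, (∀ r, algebraMap R F r ∈ V) ∧
      (∀ x ∈ V, ∃ c : K, x - algebraMap R F (algebraMap K R c) ∈ V.nonunits) ∧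
      ∀ h, ∀ τ : F →+* F, (∀ r, τ (algebraMap R F r) = algebraMap R F (α h r)) →
        ∀ x, τ x ∈ V ↔ x ∈ V := by
  obtain ⟨n, t, ht, hα⟩ := exists_isMonomialSystem hres α
  have := ht.isDomain
  have hinj := IsFractionRing.injective R F
  have hv : ∀ x, ht.valuation x = ⊤ → x = 0 := fun x ↦ ht.valuation_eq_top_iff.mp
  have hmem {a b : R} (hb : b ≠ 0) := div_mem_fractionValuationSubring_iff (F := F) (a := a) hv hb
  refine ⟨fractionValuationSubring F ht.valuation, fun r ↦ ?_, fun x hx ↦ ?_, fun h τ hτ x ↦ ?_⟩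
  · have := (hmem (a := r) one_ne_zero).mpr (by
      rw [ht.valuation.map_one]
      by_cases hr : r = 0
      · simp [hr]
      · obtain ⟨γ, hγ⟩ := ht.exists_leading hr
        rw [ht.valuation_eq_coe hγ]
        exact WithTop.coe_le_coe.mpr bot_le)
    simpa using this
  · obtain ⟨a, b, hb, hab, rfl⟩ := hx
    obtain ⟨c, hc⟩ := ht.exists_valuation_lt hb hab
    refine ⟨c, ?_⟩
    have hb' : algebraMap R F b ≠ 0 := (map_ne_zero_iff _ hinj).mpr hb
    have h1 : algebraMap R F a / algebraMap R F b - algebraMap R F (algebraMap K R c) =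
        algebraMap R F (a - algebraMap K R c * b) / algebraMap R F b := by
      rw [map_sub, map_mul, sub_div, mul_div_cancel_right₀ _ hb']
    rw [h1, ← inv_div, ValuationSubring.inv_mem_nonunits_iff]
    by_cases h0 : a - algebraMap K R c * b = 0
    · simp [h0]
    · right
      rw [hmem h0]
      exact hc.not_ge
  · obtain ⟨a, b, hb, rfl⟩ := IsFractionRing.div_surjective (A := R) x
    have hb := nonZeroDivisors.ne_zero hb
    rw [map_div₀, hτ, hτ, hmem hb, hmem ((map_ne_zero_iff _ (α h).injective).mpr hb)]
    have key : ∀ x, ht.valuation (α h x) = ht.valuation x :=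
      ht.valuation_map (α h).toRingEquiv (hα h) fun i ↦ by
        have := hα h⁻¹ i
        rwa [map_inv] at this
    rw [key, key]

end RegularValuation


/-! ### Conjugacy of valuation rings in a finite normal extension. -/

section ValuationExtension

open Polynomial
open scoped Pointwise

variable {M N : Type*} [Field M] [Field N] [Algebra M N]

/-- Divide an annihilating polynomial by a coefficient of largest valuation. -/
theorem exists_primitive_polynomial (V : ValuationSubring M) {x : N}
    (hx : IsAlgebraic M x) :
    ∃ p : M[X], (∀ j, p.coeff j ∈ V) ∧ (∃ i, p.coeff i = 1) ∧ aeval x p = 0 := by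
  obtain ⟨p, hp, hpx⟩ := hx
  obtain ⟨i, hi, hmax⟩ := p.support.exists_max_image (fun i ↦ V.valuation (p.coeff i))
    (support_nonempty.mpr hp)
  have hi0 : p.coeff i ≠ 0 := mem_support_iff.mp hi
  refine ⟨C (p.coeff i)⁻¹ * p, fun j ↦ ?_, ⟨i, by rw [coeff_C_mul, inv_mul_cancel₀ hi0]⟩, by
    rw [map_mul, hpx, mul_zero]⟩
  rw [coeff_C_mul, ← V.valuation_le_one_iff, map_mul, map_inv₀]
  by_cases hj : j ∈ p.support
  · have h0 : V.valuation (p.coeff i) ≠ 0 := (_root_.map_ne_zero _).mpr hi0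
    calc (V.valuation (p.coeff i))⁻¹ * V.valuation (p.coeff j)
        ≤ (V.valuation (p.coeff i))⁻¹ * V.valuation (p.coeff i) := by gcongr; exact hmax j hj
      _ = 1 := inv_mul_cancel₀ h0
  · rw [notMem_support_iff.mp hj, map_zero, mul_zero]
    exact zero_le_one

theorem aeval_mem_valuationSubring {V : ValuationSubring M} {O : ValuationSubring N}
    (hO : ∀ m ∈ V, algebraMap M N m ∈ O) {x : N} (hx : x ∈ O) {p : M[X]}
    (hp : ∀ j, p.coeff j ∈ V) : aeval x p ∈ O := by
  rw [aeval_eq_sum_range]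
  refine sum_mem fun j _ ↦ ?_
  rw [Algebra.smul_def]
  exact mul_mem (hO _ (hp j)) (pow_mem hx j)

/-- The intersection of the valuation rings of `N` that contain a valuation ring of `M`: the
integral closure of the latter in `N`. -/
def valuationClosure (V : ValuationSubring M) (N : Type*) [Field N] [Algebra M N] : Subring N :=
  ⨅ O : {O : ValuationSubring N // ∀ m ∈ V, algebraMap M N m ∈ O}, O.1.toSubring

theorem mem_valuationClosure {V : ValuationSubring M} {x : N} :
    x ∈ valuationClosure V N ↔
      ∀ O : ValuationSubring N, (∀ m ∈ V, algebraMap M N m ∈ O) → x ∈ O := by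
  simp [valuationClosure, Subring.mem_iInf]

theorem map_mem_valuationClosure {V : ValuationSubring M} (σ : N ≃ₐ[M] N) {x : N}
    (hx : x ∈ valuationClosure V N) : σ x ∈ valuationClosure V N := by
  rw [mem_valuationClosure] at hx ⊢
  intro O hO
  exact hx (O.comap (σ : N →+* N)) fun m hm ↦ by
    change σ _ ∈ O
    rw [σ.commutes]
    exact hO m hm

/-- An element of a valuation ring of an algebraic extension is a quotient of integral elements with
denominator a unit. -/
theorem exists_mul_mem_valuationClosure [Algebra.IsAlgebraic M N] (V : ValuationSubring M)
    {W : ValuationSubring N} {x : N} (hx : x ∈ W) :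
    ∃ b ∈ valuationClosure V N, b * x ∈ valuationClosure V N ∧ b ∉ W.nonunits := by
  obtain ⟨p, hpV, ⟨i, hi⟩, hpx⟩ :=
    exists_primitive_polynomial V (Algebra.IsAlgebraic.isAlgebraic (R := M) x)
  have hcoeff : ∀ j k, (divX^[j] p).coeff k = p.coeff (k + j) := by
    intro j
    induction j with
    | zero => simp
    | succ j ih =>
      intro k
      rw [Function.iterate_succ_apply', coeff_divX, ih]
      congr 1
      ring
  -- Horner partial evaluations: each is integral, being a polynomial in `x` or in its inverse
  -- according to the valuation ring. If all were nonunits of `W`, the coefficient equal to 1 would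
  -- be one too.
  let b : ℕ → N := fun j ↦ aeval x (divX^[j] p)
  have hb : ∀ j, b j = b (j + 1) * x + algebraMap M N (p.coeff j) := by
    intro j
    have h1 := congr_arg (aeval x) (divX_mul_X_add (divX^[j] p))
    rw [map_add, map_mul, aeval_X, aeval_C, hcoeff, zero_add, ← Function.iterate_succ_apply' divX]
      at h1
    exact h1.symm
  have hbC : ∀ j, b j ∈ valuationClosure V N := by
    intro j
    rw [mem_valuationClosure]
    intro O hO
    rcases O.mem_or_inv_mem x with hxO | hxO
    · exact aeval_mem_valuationSubring hO hxO fun k ↦ hcoeff j k ▸ hpV _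
    · by_cases hx0 : x = 0
      · exact aeval_mem_valuationSubring hO (hx0 ▸ zero_mem O) fun k ↦ hcoeff j k ▸ hpV _
      induction j with
      | zero =>
        change aeval x p ∈ O
        rw [hpx]
        exact zero_mem O
      | succ j ih =>
        have : b (j + 1) = (b j - algebraMap M N (p.coeff j)) * x⁻¹ := by
          rw [hb j, add_sub_cancel_right, mul_inv_cancel_right₀ hx0]
        rw [this]
        exact mul_mem (sub_mem ih (hO _ (hpV j))) hxO
  have hVC : ∀ m ∈ V, algebraMap M N m ∈ valuationClosure V N := fun m hm ↦
    mem_valuationClosure.mpr fun O hO ↦ hO m hm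
  by_contra! hcon
  have hbW : ∀ j, b (j + 1) ∈ W.nonunits := fun j ↦ hcon _ (hbC _) (by
    have : b (j + 1) * x = b j - algebraMap M N (p.coeff j) := by rw [hb j, add_sub_cancel_right]
    rw [this]
    exact sub_mem (hbC j) (hVC _ (hpV j)))
  have hb0 : b 0 ∈ W.nonunits := by
    change aeval x p ∈ W.nonunits
    rw [hpx]
    exact zero_mem _
  have hbW' : ∀ j, b j ∈ W.nonunits := fun j ↦ by
    cases j with
    | zero => exact hb0
    | succ j => exact hbW j
  have h1 : (1 : N) ∈ W.nonunits := by
    have h2 : (1 : N) = b i - b (i + 1) * x := by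
      rw [hb i, hi, map_one]
      ring
    rw [h2]
    refine sub_mem (hbW' i) ?_
    rw [ValuationSubring.mem_nonunits_iff, map_mul]
    exact mul_lt_one_of_lt_of_le ((ValuationSubring.mem_nonunits_iff _).mp (hbW' _))
      ((W.valuation_le_one_iff x).mpr hx)
  rw [ValuationSubring.mem_nonunits_iff, map_one] at h1
  exact lt_irrefl _ h1

/-- Each element of `W` is a quotient of integral elements with denominator a unit of `W`; by
hypothesis that denominator is also a unit of `W'`. -/
theorem valuationSubring_le_of_nonunits [Algebra.IsAlgebraic M N] {V : ValuationSubring M}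
    {W W' : ValuationSubring N}
    (hW' : W'.comap (algebraMap M N) = V)
    (h : ∀ x ∈ valuationClosure V N, x ∈ W'.nonunits → x ∈ W.nonunits) : W ≤ W' := by
  intro x hx
  obtain ⟨b, hb, hbx, hbW⟩ := exists_mul_mem_valuationClosure V hx
  have hbW' : b ∉ W'.nonunits := fun hb' ↦ hbW (h b hb hb')
  rw [ValuationSubring.mem_nonunits_iff_or] at hbW'
  push Not at hbW'
  have hO' : ∀ m ∈ V, algebraMap M N m ∈ W' := fun m hm ↦ by
    rw [← hW'] at hm
    exact hm
  have := mul_mem hbW'.2 (mem_valuationClosure.mp hbx W' hO')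
  rwa [inv_mul_cancel_left₀ hbW'.1] at this

theorem prod_mem_nonunits {W : ValuationSubring N} {s : Multiset N} (hs : ∀ x ∈ s, x ∈ W)
    {x : N} (hx : x ∈ s) (hxW : x ∈ W.nonunits) : s.prod ∈ W.nonunits := by
  obtain ⟨t, rfl⟩ := Multiset.exists_cons_of_mem hx
  rw [Multiset.prod_cons, ValuationSubring.mem_nonunits_iff, map_mul]
  refine mul_lt_one_of_lt_of_le ((ValuationSubring.mem_nonunits_iff _).mp hxW) ?_
  rw [ValuationSubring.valuation_le_one_iff]
  exact multiset_prod_mem _ fun y hy ↦ hs y (Multiset.mem_cons_of_mem hy)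

theorem exists_mem_nonunits_of_prod {W : ValuationSubring N} {s : Multiset N}
    (hs : s.prod ∈ W.nonunits) (hsW : ∀ x ∈ s, x ∈ W) : ∃ x ∈ s, x ∈ W.nonunits := by
  induction s using Multiset.induction with
  | empty =>
    rw [Multiset.prod_zero, ValuationSubring.mem_nonunits_iff, map_one] at hs
    exact absurd hs (lt_irrefl _)
  | cons a s ih =>
    by_contra! hcon
    have h1 : s.prod ∉ W.nonunits := fun h ↦ by
      obtain ⟨x, hx, hxW⟩ := ih h fun x hx ↦ hsW x (Multiset.mem_cons_of_mem hx)
      exact hcon x (Multiset.mem_cons_of_mem hx) hxW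
    have h2 := hcon a (Multiset.mem_cons_self a s)
    rw [ValuationSubring.mem_nonunits_iff, not_lt] at h1 h2
    rw [Multiset.prod_cons, ValuationSubring.mem_nonunits_iff, map_mul] at hs
    exact hs.not_ge (one_le_mul h2 h1)

/-- Valuation rings of a finite normal extension lying over the same valuation ring are conjugate
(here up to inclusion). -/
theorem exists_smul_valuationSubring_le [FiniteDimensional M N] [Normal M N]
    {W W' : ValuationSubring N} (h : W.comap (algebraMap M N) = W'.comap (algebraMap M N)) :
    ∃ σ : N ≃ₐ[M] N, σ • W ≤ W' := by
  set V := W.comap (algebraMap M N) with hV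
  let B := valuationClosure V N
  have hBW : ∀ x ∈ B, x ∈ W := fun x hx ↦ mem_valuationClosure.mp hx W fun m hm ↦ hm
  have hBW' : ∀ x ∈ B, x ∈ W' := fun x hx ↦ mem_valuationClosure.mp hx W' fun m hm ↦ by
    rw [h] at hm; exact hm
  let i' : B →+* W' := (Subring.inclusion (S := B) (T := W'.toSubring) hBW')
  let i : (N ≃ₐ[M] N) → B →+* W := fun σ ↦
    ((σ : N →+* N).comp B.subtype).codRestrict W.toSubring fun x ↦
      hBW _ (map_mem_valuationClosure σ x.2)
  by_contra! hcon
  have key : ∀ σ : N ≃ₐ[M] N, ¬ (IsLocalRing.maximalIdeal W').comap i' ≤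
      (IsLocalRing.maximalIdeal W).comap (i σ) := by
    intro σ hle
    refine hcon σ⁻¹ (valuationSubring_le_of_nonunits (V := V) h.symm fun x hx hxW' ↦ ?_)
    have h1 : (⟨x, hx⟩ : B) ∈ (IsLocalRing.maximalIdeal W).comap (i σ) := hle (by
      rw [Ideal.mem_comap, ← ValuationSubring.coe_mem_nonunits_iff]
      exact hxW')
    rw [Ideal.mem_comap, ← ValuationSubring.coe_mem_nonunits_iff,
      ValuationSubring.mem_nonunits_iff_or] at h1
    change σ x = 0 ∨ (σ x)⁻¹ ∉ W at h1
    rw [ValuationSubring.mem_nonunits_iff_or,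
      ValuationSubring.mem_pointwise_smul_iff_inv_smul_mem, inv_inv, AlgEquiv.smul_def, map_inv₀]
    simpa using h1
  -- If no conjugate of `W` lies in `W'`, prime avoidance gives an integral `x` in the maximal ideal
  -- of `W'` with no conjugate in that of `W`. The product of the roots of its minimal polynomial
  -- lies, up to sign, in `M`, where the two maximal ideals agree: a contradiction.
  have : ¬ (((IsLocalRing.maximalIdeal W').comap i' : Ideal B) : Set B) ⊆
      ⋃ σ ∈ ((Finset.univ : Finset (N ≃ₐ[M] N)) : Set (N ≃ₐ[M] N)),
        (((IsLocalRing.maximalIdeal W).comap (i σ) : Ideal B) : Set B) := by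
    rw [Ideal.subset_union_prime (1 : N ≃ₐ[M] N) 1 fun σ _ _ _ ↦ inferInstance]
    push Not
    exact fun σ _ ↦ key σ
  obtain ⟨⟨x, hxB⟩, hx, hx'⟩ := Set.not_subset.mp this
  have hxW' : x ∈ W'.nonunits := ValuationSubring.coe_mem_nonunits_iff.mpr hx
  have hσx : ∀ σ : N ≃ₐ[M] N, σ x ∉ W.nonunits := by
    intro σ hσ
    exact hx' (Set.mem_biUnion (Finset.mem_coe.mpr (Finset.mem_univ σ))
      (ValuationSubring.coe_mem_nonunits_iff.mp hσ))
  have hint : IsIntegral M x := Algebra.IsIntegral.isIntegral x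
  have hsplits := Normal.splits (F := M) inferInstance x
  have hroots : ∀ y ∈ ((minpoly M x).map (algebraMap M N)).roots, ∃ σ : N ≃ₐ[M] N, σ x = y := by
    intro y hy
    rw [mem_roots_map (minpoly.ne_zero hint)] at hy
    obtain ⟨σ, hσ⟩ := minpoly.exists_algEquiv_of_root' (Algebra.IsAlgebraic.isAlgebraic x) hy
    exact ⟨σ, hσ⟩
  have hcoeff := hsplits.coeff_zero_eq_prod_roots_of_monic
    ((minpoly.monic hint).map (algebraMap M N))
  set s := ((minpoly M x).map (algebraMap M N)).roots with hs
  have hxs : x ∈ s := by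
    rw [hs, mem_roots_map (minpoly.ne_zero hint), ← aeval_def, minpoly.aeval]
  have hsB : ∀ y ∈ s, y ∈ B := fun y hy ↦ by
    obtain ⟨σ, rfl⟩ := hroots y hy
    exact map_mem_valuationClosure σ hxB
  have hneg : ∀ (O : ValuationSubring N) (k : ℕ) (y : N),
      (-1) ^ k * y ∈ O.nonunits ↔ y ∈ O.nonunits := by
    intro O k y
    rw [ValuationSubring.mem_nonunits_iff, ValuationSubring.mem_nonunits_iff, map_mul, map_pow,
      Valuation.map_neg, map_one, one_pow, one_mul]
  have h1 := prod_mem_nonunits (fun y hy ↦ hBW' y (hsB y hy)) hxs hxW'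
  rw [← hneg _ ((minpoly M x).map (algebraMap M N)).natDegree, ← hcoeff, coeff_map,
    ValuationSubring.mem_nonunits_iff_or, ← map_inv₀] at h1
  have h2 : algebraMap M N ((minpoly M x).coeff 0) ∈ W.nonunits := by
    rw [ValuationSubring.mem_nonunits_iff_or, ← map_inv₀]
    refine h1.imp_right fun h3 h4 ↦ h3 ?_
    have h5 : ((minpoly M x).coeff 0)⁻¹ ∈ V := h4
    rw [h] at h5
    exact h5
  rw [← coeff_map, hcoeff, hneg] at h2
  obtain ⟨y, hy, hyW⟩ := exists_mem_nonunits_of_prod h2 fun y hy ↦ hBW y (hsB y hy)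
  obtain ⟨σ, rfl⟩ := hroots y hy
  exact hσx σ hyW

end ValuationExtension


/-! ### Extending an invariant valuation ring in degree prime to `q`. -/

section InvariantExtension

open Polynomial
open scoped Pointwise

/-- Take a valuation ring dominating the image of `V`. An inverse that lies in `V` and becomes a
unit above is already a unit in `V`, so the trace is no larger than `V`. -/
theorem exists_comap_valuationSubring_eq {M N : Type*} [Field M] [Field N] [Algebra M N]
    (V : ValuationSubring M) : ∃ W : ValuationSubring N, W.comap (algebraMap M N) = V := by
  obtain ⟨W, hle, hloc⟩ := (V.toLocalSubring.map (algebraMap M N)).exists_le_valuationSubring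
  have hVW : ∀ m ∈ V, algebraMap M N m ∈ W := fun m hm ↦ hle ⟨m, hm, rfl⟩
  refine ⟨W, ?_⟩
  ext m
  refine ⟨fun hm ↦ ?_, hVW m⟩
  rcases V.mem_or_inv_mem m with h | h
  · exact h
  by_cases hm0 : m = 0
  · exact hm0 ▸ zero_mem V
  let a : (V.toLocalSubring.map (algebraMap M N)).toSubring := ⟨algebraMap M N m⁻¹, m⁻¹, h, rfl⟩
  have ha : IsUnit (Subring.inclusion hle a) := by
    refine IsUnit.of_mul_eq_one (⟨algebraMap M N m, hm⟩ : W.toSubring) (Subtype.ext ?_)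
    change algebraMap M N m⁻¹ * algebraMap M N m = 1
    rw [← map_mul, inv_mul_cancel₀ hm0, map_one]
  obtain ⟨⟨_, c, hc, rfl⟩, hb⟩ := (hloc.map_nonunit a ha).exists_right_inv
  have h1 : algebraMap M N (m⁻¹ * c) = algebraMap M N 1 := by
    rw [map_mul, map_one]
    exact congr_arg Subtype.val hb
  have h2 : m⁻¹ * c = 1 := (algebraMap M N).injective h1
  rw [inv_mul_eq_one₀ hm0] at h2
  exact h2 ▸ hc

/-- Iterating the inclusion up to the finite order of `σ` closes the chain. Hence conjugacy up to
inclusion suffices. -/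
theorem smul_valuationSubring_eq_of_le {G N : Type*} [Group G] [Finite G] [Field N]
    [MulSemiringAction G N] {W : ValuationSubring N} {σ : G} (h : σ • W ≤ W) : σ • W = W := by
  have hk : ∀ k : ℕ, σ ^ k • W ≤ W := by
    intro k
    induction k with
    | zero => rw [pow_zero, one_smul]
    | succ k ih =>
      rw [pow_succ', mul_smul]
      exact (ValuationSubring.pointwise_smul_le_pointwise_smul_iff.mpr ih).trans h
  refine le_antisymm h ?_
  rw [ValuationSubring.subset_pointwise_smul_iff]
  obtain ⟨n, hn, hσ⟩ := (isOfFinOrder_of_finite σ).exists_pow_eq_one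
  obtain ⟨k, rfl⟩ := Nat.exists_eq_succ_of_ne_zero hn.ne'
  rw [inv_eq_of_mul_eq_one_right ((pow_succ' σ k).symm.trans hσ)]
  exact hk k

/-- An automorphism that preserves a valuation ring lifts to an automorphism of a normal extension
that preserves a given valuation ring above. -/
theorem exists_algEquiv_lift_valuationSubring {F M N : Type*} [Field F] [Field M] [Field N]
    [Algebra F M] [Algebra M N] [Algebra F N] [IsScalarTower F M N] [FiniteDimensional F N]
    [Normal F N] (W : ValuationSubring N) (h : M ≃ₐ[F] M)
    (hV : ∀ m, algebraMap M N (h m) ∈ W ↔ algebraMap M N m ∈ W) :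
    ∃ σ : N ≃ₐ[F] N, (∀ m, σ (algebraMap M N m) = algebraMap M N (h m)) ∧
      ∀ x, σ x ∈ W ↔ x ∈ W := by
  have : FiniteDimensional M N := FiniteDimensional.right F M N
  have : Normal M N := Normal.tower_top_of_normal F M N
  -- An arbitrary lift moves `W` to another valuation ring with the same trace on `M`; conjugacy
  -- over `M` corrects it.
  let τ : N ≃ₐ[F] N := h.liftNormal N
  have hτ : ∀ m, τ (algebraMap M N m) = algebraMap M N (h m) := h.liftNormal_commutes N
  have hτ' : ∀ m, τ⁻¹ (algebraMap M N m) = algebraMap M N (h.symm m) := fun m ↦ by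
    rw [AlgEquiv.aut_inv, AlgEquiv.symm_apply_eq, hτ, AlgEquiv.apply_symm_apply]
  obtain ⟨g, hg⟩ := exists_smul_valuationSubring_le (W := τ • W) (W' := W) (M := M) (by
    ext m
    change algebraMap M N m ∈ τ • W ↔ algebraMap M N m ∈ W
    rw [ValuationSubring.mem_pointwise_smul_iff_inv_smul_mem, AlgEquiv.smul_def, hτ', ← hV,
      AlgEquiv.apply_symm_apply])
  let σ : N ≃ₐ[F] N := g.restrictScalars F * τ
  have hσ : σ • W = W := smul_valuationSubring_eq_of_le (by
    rw [mul_smul]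
    exact hg)
  refine ⟨σ, fun m ↦ ?_, fun x ↦ ?_⟩
  · change g (τ _) = _
    rw [hτ, g.commutes]
  · conv_lhs => rw [← hσ]
    exact ValuationSubring.smul_mem_pointwise_smul_iff

/-- The chosen lifts `σ h` need not compose, so `H` does not act on the embeddings of `L` in `N` by
`e`. They do show that `c W`, the number of embeddings inducing `W`, is invariant, so `H` acts on
the set `T` of pairs of a ring `W` and an index below `c W`. The cardinality of `T` is the separable
degree, hence prime to `q`. -/
theorem exists_invariant_valuationSubring_of_normal {F M L N : Type*} [Field F] [Field M]
    [Field L] [Field N] [Algebra F M] [Algebra M L] [Algebra L N] [Algebra M N] [Algebra F N]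
    [IsScalarTower F M N] [IsScalarTower M L N] [FiniteDimensional F N] [Normal F N]
    {H : Type*} [Group H] {q : ℕ} [Fact q.Prime] (hH : IsPGroup q H)
    [MulSemiringAction H M] [SMulCommClass H F M] [MulSemiringAction H L]
    (hcompat : ∀ (h : H) (m : M), algebraMap M L (h • m) = h • algebraMap M L m)
    (hq : ¬ q ∣ Module.finrank M L) (V : ValuationSubring M)
    (hV : ∀ (h : H) (m : M), h • m ∈ V ↔ m ∈ V) :
    ∃ W : ValuationSubring L, W.comap (algebraMap M L) = V ∧
      ∀ (h : H) (x : L), h • x ∈ W ↔ x ∈ W := by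
  have : FiniteDimensional M N := FiniteDimensional.right F M N
  have : Normal M N := Normal.tower_top_of_normal F M N
  obtain ⟨W₀, hW₀⟩ := exists_comap_valuationSubring_eq (N := N) V
  have hW₀' : ∀ m, algebraMap M N m ∈ W₀ ↔ m ∈ V := fun m ↦ by rw [← hW₀]; rfl
  choose σ hσM hσW using fun h : H ↦ exists_algEquiv_lift_valuationSubring (F := F) W₀
    (MulSemiringAction.toAlgEquiv F M h) fun m ↦ by
      rw [hW₀', hW₀', MulSemiringAction.toAlgEquiv_apply, hV]
  have : FiniteDimensional M L := FiniteDimensional.left M L N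
  let Φ : (L →ₐ[M] N) → ValuationSubring L := fun φ ↦ W₀.comap (φ : L →+* N)
  let c : ValuationSubring L → ℕ := fun W ↦ Nat.card {φ // Φ φ = W}
  let e : H → (L →ₐ[M] N) → (L →ₐ[M] N) := fun h φ ↦
    { ((σ h : N →+* N).comp (φ : L →+* N)).comp (MulSemiringAction.toRingHom H L h⁻¹) with
      commutes' := fun m ↦ by
        change σ h (φ (h⁻¹ • algebraMap M L m)) = _
        rw [← hcompat, φ.commutes, hσM, MulSemiringAction.toAlgEquiv_apply, smul_inv_smul] }
  have he : ∀ h φ x, e h φ x = σ h (φ (h⁻¹ • x)) := fun _ _ _ ↦ rfl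
  have heΦ : ∀ h φ, Φ (e h φ) = h • Φ φ := fun h φ ↦ by
    ext x
    rw [ValuationSubring.mem_pointwise_smul_iff_inv_smul_mem]
    exact hσW h _
  have he_inj : ∀ h, Function.Injective (e h) := fun h φ ψ hφψ ↦ by
    ext x
    have := DFunLike.congr_fun hφψ (h • x)
    rwa [he, he, inv_smul_smul, (σ h).injective.eq_iff] at this
  have hc_le : ∀ h W, c W ≤ c (h • W) := fun h W ↦
    Nat.card_le_card_of_injective
      (fun φ : {φ // Φ φ = W} ↦ (⟨e h φ.1, by rw [heΦ, φ.2]⟩ : {φ // Φ φ = h • W}))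
      fun φ ψ hφψ ↦ Subtype.ext (he_inj h (congr_arg Subtype.val hφψ))
  have hc : ∀ h W, c (h • W) = c W := fun h W ↦
    le_antisymm (by simpa using hc_le h⁻¹ (h • W)) (hc_le h W)
  let T := {x : ValuationSubring L × ℕ // x.2 < c x.1}
  let : MulAction H T :=
    { smul := fun h x ↦ ⟨(h • x.1.1, x.1.2), by rw [hc]; exact x.2⟩
      one_smul := fun x ↦ Subtype.ext (Prod.ext (one_smul H _) rfl)
      mul_smul := fun g h x ↦ Subtype.ext (Prod.ext (mul_smul g h _) rfl) }
  have hT : Nat.card T = Nat.card (L →ₐ[M] N) := by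
    refine Nat.card_congr ?_
    refine (Equiv.subtypeProdEquivSigmaSubtype fun (W : ValuationSubring L) k ↦ k < c W).trans ?_
    refine (Equiv.sigmaCongrRight fun W ↦ ?_).trans (Equiv.sigmaFiberEquiv Φ)
    exact Fin.equivSubtype.symm.trans (Finite.equivFin _).symm
  have hcard : Nat.card (L →ₐ[M] N) = Field.finSepDegree M L := by
    refine (Field.finSepDegree_eq_of_adjoin_splits M L N (S := Set.univ)
      (IntermediateField.adjoin_univ _ _) fun s _ ↦ ⟨Algebra.IsIntegral.isIntegral s, ?_⟩).symm
    rw [← minpoly.algebraMap_eq (algebraMap L N).injective s]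
    exact Normal.splits inferInstance _
  have hqT : ¬ q ∣ Nat.card T := fun hdvd ↦ hq <|
    (hdvd.trans (hT.trans hcard).dvd).trans (Field.finSepDegree_dvd_finrank M L)
  obtain ⟨⟨⟨W, k⟩, hk⟩, hfix⟩ := hH.nonempty_fixed_point_of_prime_not_dvd_card T hqT
  have hW : ∀ h : H, h • W = W := fun h ↦ congr_arg (fun x : T ↦ x.1.1) (hfix h)
  obtain ⟨⟨φ, hφ⟩⟩ : Nonempty {φ // Φ φ = W} := by
    refine (Nat.card_pos_iff.mp ((Nat.zero_le k).trans_lt hk)).1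
  refine ⟨W, ?_, fun h x ↦ ?_⟩
  · ext m
    rw [← hφ, ← hW₀']
    change φ (algebraMap M L m) ∈ W₀ ↔ _
    rw [φ.commutes]
  · conv_lhs => rw [← hW h]
    exact ValuationSubring.smul_mem_pointwise_smul_iff

theorem exists_invariant_valuationSubring_of_tower {F M L : Type*} [Field F] [Field M]
    [Field L] [Algebra F M] [Algebra M L] [Algebra F L] [IsScalarTower F M L]
    [FiniteDimensional F L] {H : Type*} [Group H] {q : ℕ} [Fact q.Prime] (hH : IsPGroup q H)
    [MulSemiringAction H M] [SMulCommClass H F M] [MulSemiringAction H L]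
    (hcompat : ∀ (h : H) (m : M), algebraMap M L (h • m) = h • algebraMap M L m)
    (hq : ¬ q ∣ Module.finrank M L) (V : ValuationSubring M)
    (hV : ∀ (h : H) (m : M), h • m ∈ V ↔ m ∈ V) :
    ∃ W : ValuationSubring L, W.comap (algebraMap M L) = V ∧
      ∀ (h : H) (x : L), h • x ∈ W ↔ x ∈ W := by
  have : Algebra.IsAlgebraic F (AlgebraicClosure L) := Algebra.IsAlgebraic.trans F L _
  have : IsAlgClosure F (AlgebraicClosure L) := ⟨inferInstance, inferInstance⟩
  have : Normal F (AlgebraicClosure L) := IsAlgClosure.normal F _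
  let N := IntermediateField.normalClosure F L (AlgebraicClosure L)
  let : Algebra M N := ((algebraMap L N).comp (algebraMap M L)).toAlgebra
  have : IsScalarTower M L N := .of_algebraMap_eq' rfl
  have : IsScalarTower F M N := .of_algebraMap_eq fun x ↦ by
    rw [IsScalarTower.algebraMap_apply M L N, ← IsScalarTower.algebraMap_apply F M L,
      ← IsScalarTower.algebraMap_apply F L N]
  have : FiniteDimensional F N := normalClosure.is_finiteDimensional F L _
  have : Normal F N := normalClosure.normal F L _
  exact exists_invariant_valuationSubring_of_normal (F := F) (N := N) hH hcompat hq V hV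

/-- A valuation ring that is invariant under a `q`-group extends to an invariant valuation ring of
any equivariant field extension of degree prime to `q`. -/
theorem exists_invariant_valuationSubring_extension {M L : Type*} [Field M] [Field L]
    [Algebra M L] [FiniteDimensional M L] {H : Type*} [Group H] [Finite H] {q : ℕ}
    [Fact q.Prime] (hH : IsPGroup q H) [MulSemiringAction H M] [MulSemiringAction H L]
    (hcompat : ∀ (h : H) (m : M), algebraMap M L (h • m) = h • algebraMap M L m)
    (hq : ¬ q ∣ Module.finrank M L) (V : ValuationSubring M)
    (hV : ∀ (h : H) (m : M), h • m ∈ V ↔ m ∈ V) :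
    ∃ W : ValuationSubring L, W.comap (algebraMap M L) = V ∧
      ∀ (h : H) (x : L), h • x ∈ W ↔ x ∈ W :=
  -- Over the fixed field of the finite group `H` the action on `M` is linear and `M` is finite, so
  -- a finite normal closure is available.
  have : FiniteDimensional (FixedPoints.subfield H M) L :=
    FiniteDimensional.trans (FixedPoints.subfield H M) M L
  exists_invariant_valuationSubring_of_tower (F := FixedPoints.subfield H M) hH hcompat hq V hV

/-- The residue field of a valuation ring does not grow in an algebraic extension if it is
algebraically closed. -/
theorem exists_sub_mem_nonunits {K M L : Type*} [Field K] [IsAlgClosed K] [Field M] [Field L]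
    [Algebra M L] [Algebra.IsAlgebraic M L] (i : K →+* M) {V : ValuationSubring M}
    (hi : ∀ c, i c ∈ V) (hV : ∀ x ∈ V, ∃ c : K, x - i c ∈ V.nonunits) {W : ValuationSubring L}
    (hW : W.comap (algebraMap M L) = V) {x : L} (hx : x ∈ W) :
    ∃ c : K, x - algebraMap M L (i c) ∈ W.nonunits := by
  obtain ⟨p, hpV, ⟨k, hk⟩, hpx⟩ :=
    exists_primitive_polynomial V (Algebra.IsAlgebraic.isAlgebraic (R := M) x)
  have hVW : ∀ m, algebraMap M L m ∈ W ↔ m ∈ V := fun m ↦ by rw [← hW]; rfl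
  have hnu : ∀ m ∈ V.nonunits, algebraMap M L m ∈ W.nonunits := fun m hm ↦ by
    rw [ValuationSubring.mem_nonunits_iff_or] at hm ⊢
    rcases hm with rfl | hm
    · exact Or.inl (map_zero _)
    · exact Or.inr (by rwa [← map_inv₀, hVW])
  choose c hc using fun j ↦ hV _ (hpV j)
  let f : K →+* L := (algebraMap M L).comp i
  have hf : ∀ a, f a ∈ W := fun a ↦ (hVW _).mpr (hi a)
  -- The reduction of `p`, nonzero because `p` has a coefficient 1. It splits over `K`, and since
  -- its value at `x` lies in the maximal ideal, so does some factor `x - a`.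
  let P : K[X] := ∑ j ∈ Finset.range (p.natDegree + 1), C (c j) * X ^ j
  have hP0 : P ≠ 0 := fun h0 ↦ by
    have hkd : k ≤ p.natDegree := le_natDegree_of_ne_zero (by rw [hk]; exact one_ne_zero)
    have h1 : P.coeff k = c k := by
      simp only [P, finsetSum_coeff, coeff_C_mul_X_pow]
      rw [Finset.sum_ite_eq, if_pos (Finset.mem_range.mpr (Nat.lt_succ_of_le hkd))]
    have h2 := hc k
    rw [← h1, h0, coeff_zero, map_zero, sub_zero, hk, ValuationSubring.mem_nonunits_iff,
      map_one] at h2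
    exact lt_irrefl _ h2
  have hPx : P.eval₂ f x ∈ W.nonunits := by
    have h1 : P.eval₂ f x =
        -∑ j ∈ Finset.range (p.natDegree + 1), algebraMap M L (p.coeff j - i (c j)) * x ^ j := by
      rw [← sub_eq_zero, sub_neg_eq_add, eval₂_finsetSum, ← Finset.sum_add_distrib, ← hpx,
        aeval_eq_sum_range]
      refine Finset.sum_congr rfl fun j _ ↦ ?_
      rw [eval₂_mul, eval₂_C, eval₂_pow, eval₂_X, Algebra.smul_def, map_sub]
      simp only [f, RingHom.comp_apply]
      ring
    rw [h1]
    refine neg_mem (sum_mem fun j _ ↦ ?_)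
    rw [ValuationSubring.mem_nonunits_iff, map_mul]
    exact mul_lt_one_of_lt_of_le ((ValuationSubring.mem_nonunits_iff _).mp (hnu _ (hc j)))
      ((W.valuation_le_one_iff _).mpr (pow_mem hx j))
  have hlc : f P.leadingCoeff * (P.roots.map fun a ↦ x - f a).prod = P.eval₂ f x := by
    conv_rhs => rw [(IsAlgClosed.splits P).eq_prod_roots]
    rw [eval₂_mul, eval₂_C, ← coe_eval₂RingHom, map_multiset_prod, Multiset.map_map]
    congr 3
    ext a
    simp
  have hprod : (P.roots.map fun a ↦ x - f a).prod ∈ W.nonunits := by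
    have h1 : f P.leadingCoeff⁻¹ * P.eval₂ f x = (P.roots.map fun a ↦ x - f a).prod := by
      rw [← hlc, map_inv₀, inv_mul_cancel_left₀]
      rwa [Ne, _root_.map_eq_zero, leadingCoeff_eq_zero]
    rw [← h1, mul_comm, ValuationSubring.mem_nonunits_iff, map_mul]
    exact mul_lt_one_of_lt_of_le ((ValuationSubring.mem_nonunits_iff _).mp hPx)
      ((W.valuation_le_one_iff _).mpr (hf _))
  obtain ⟨y, hy, hyW⟩ := exists_mem_nonunits_of_prod hprod fun y hy ↦ by
    obtain ⟨a, -, rfl⟩ := Multiset.mem_map.mp hy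
    exact sub_mem hx (hf a)
  obtain ⟨a, -, rfl⟩ := Multiset.mem_map.mp hy
  exact ⟨a, hyW⟩

end InvariantExtension


/-! ### From an invariant valuation ring to a fixed point. -/

section FixedPoint

variable {K : Type u} [Field K] {H : Type v} [CommGroup H]

theorem exists_invariant_valuationSubring_of_formallySmooth_subring [IsAlgClosed K] [Finite H]
    {q : ℕ} [Fact q.Prime] (hH : IsPGroup q H)
    {R M L : Type*} [CommRing R] [IsLocalRing R] [IsNoetherianRing R] [Algebra K R]
    [Algebra.FormallySmooth K R]
    (hres : ∀ r : R, ∃ c : K, r - algebraMap K R c ∈ IsLocalRing.maximalIdeal R)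
    [Field M] [Algebra R M] [IsFractionRing R M] [Field L] [Algebra M L] [FiniteDimensional M L]
    (hq : ¬ q ∣ Module.finrank M L)
    (α : H →* (R →+* R)) (hα : ∀ h c, α h (algebraMap K R c) = algebraMap K R c)
    (β : H →* (M →+* M)) (hβ : ∀ h r, β h (algebraMap R M r) = algebraMap R M (α h r))
    (γ : H →* (L →+* L)) (hγ : ∀ h m, γ h (algebraMap M L m) = algebraMap M L (β h m)) :
    ∃ W : ValuationSubring L,
      (∀ c : K, algebraMap M L (algebraMap R M (algebraMap K R c)) ∈ W) ∧
      (∀ x ∈ W, ∃ c : K, x - algebraMap M L (algebraMap R M (algebraMap K R c)) ∈ W.nonunits) ∧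
      ∀ h x, γ h x ∈ W ↔ x ∈ W := by
  have hα' : ∀ g h, (α g).comp (α h) = α (g * h) := fun g h ↦ (map_mul α g h).symm
  let α' : H →* (R ≃ₐ[K] R) :=
    { toFun := fun h ↦ AlgEquiv.ofAlgHom ⟨α h, hα h⟩ ⟨α h⁻¹, hα h⁻¹⟩
        (AlgHom.ext fun r ↦ by
          change ((α h).comp (α h⁻¹)) r = r
          rw [hα', mul_inv_cancel, map_one]
          rfl)
        (AlgHom.ext fun r ↦ by
          change ((α h⁻¹).comp (α h)) r = r
          rw [hα', inv_mul_cancel, map_one]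
          rfl)
      map_one' := AlgEquiv.ext fun r ↦ by
        change α 1 r = r
        rw [map_one]
        rfl
      map_mul' := fun g h ↦ AlgEquiv.ext fun r ↦ by
        change α (g * h) r = α g (α h r)
        rw [map_mul]
        rfl }
  obtain ⟨V, hRV, hVres, hVinv⟩ :=
    exists_invariant_valuationSubring_of_formallySmooth hres α' M
  let : MulSemiringAction H M := MulSemiringAction.compHom M β
  let : MulSemiringAction H L := MulSemiringAction.compHom L γ
  obtain ⟨W, hWV, hW⟩ := exists_invariant_valuationSubring_extension hH (fun h m ↦ (hγ h m).symm)
    hq V fun h m ↦ hVinv h (β h) (hβ h) m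
  refine ⟨W, fun c ↦ ?_, fun x hx ↦ ?_, hW⟩
  · have := hRV (algebraMap K R c)
    rw [← hWV] at this
    exact this
  · exact exists_sub_mem_nonunits ((algebraMap R M).comp (algebraMap K R)) (fun c ↦ hRV _)
      hVres hWV hx

/-- Expresses the residue map with values in `K` itself, so that it defines a `K`-point of `Spec W`.
-/
theorem exists_residue_hom {L : Type u} [Field L] (i : K →+* L) (W : ValuationSubring L)
    (hi : ∀ c, i c ∈ W) (hres : ∀ x ∈ W, ∃ c : K, x - i c ∈ W.nonunits) :
    ∃ r : W →+* K, ∀ (x : W) (c : K), r x = c ↔ (x : L) - i c ∈ W.nonunits := by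
  let i' : K →+* W := i.codRestrict W.toSubring hi
  let k : K →+* IsLocalRing.ResidueField W := (IsLocalRing.residue W).comp i'
  have hk : ∀ (x : W) (c : K), IsLocalRing.residue W x = k c ↔ (x : L) - i c ∈ W.nonunits := by
    intro x c
    rw [← sub_eq_zero, RingHom.comp_apply, ← map_sub, IsLocalRing.residue_eq_zero_iff,
      ← ValuationSubring.coe_mem_nonunits_iff]
    rfl
  have hkb : Function.Bijective k := ⟨k.injective, fun y ↦ by
    obtain ⟨x, rfl⟩ := IsLocalRing.residue_surjective y
    obtain ⟨c, hc⟩ := hres x x.2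
    exact ⟨c, ((hk x c).mpr hc).symm⟩⟩
  let e := RingEquiv.ofBijective k hkb
  refine ⟨(e.symm : IsLocalRing.ResidueField W →+* K).comp (IsLocalRing.residue W), fun x c ↦ ?_⟩
  rw [← hk]
  change e.symm _ = c ↔ _
  rw [RingEquiv.symm_apply_eq]
  rfl

/-- An equivariant point of a proper scheme, with values in a field with an invariant valuation
ring whose residue field is the ground field, specializes to a fixed point. -/
theorem hasFixedPoint_of_valuationSubring {Y : Scheme.{u}} [Y.Over (Spec (.of K))]
    (ρ : SchemeAction (Spec (.of K)) H Y) [IsProper (Y ↘ Spec (.of K))]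
    {L : Type u} [Field L] (i : K →+* L) (a : H → L →+* L) (hai : ∀ h c, a h (i c) = i c)
    (y : Spec (.of L) ⟶ Y) (hy : y ≫ (Y ↘ Spec (.of K)) = Spec.map (CommRingCat.ofHom i))
    (hya : ∀ h, Spec.map (CommRingCat.ofHom (a h)) ≫ y = y ≫ ρ.act h)
    (W : ValuationSubring L) (hi : ∀ c, i c ∈ W)
    (hres : ∀ x ∈ W, ∃ c : K, x - i c ∈ W.nonunits) (ha : ∀ h x, a h x ∈ W ↔ x ∈ W) :
    ρ.HasFixedPoint := by
  obtain ⟨r, hr⟩ := exists_residue_hom i W hi hres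
  let i' : K →+* W := i.codRestrict W.toSubring hi
  let a' : H → W →+* W := fun h ↦
    ((a h).comp (algebraMap W L)).codRestrict W.toSubring fun x ↦ (ha h x).mpr x.2
  have hri : r.comp i' = RingHom.id K := RingHom.ext fun c ↦ (hr _ _).mpr (by
    change i c - i c ∈ _
    rw [sub_self]
    exact zero_mem _)
  have hra : ∀ h, r.comp (a' h) = r := fun h ↦ RingHom.ext fun x ↦ (hr _ _).mpr (by
    have h1 : (x : L) - i (r x) ∈ W.nonunits := (hr x _).mp rfl
    rw [ValuationSubring.mem_nonunits_iff_or] at h1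
    change a h x - i (r x) ∈ _
    rw [← hai h, ← map_sub, ValuationSubring.mem_nonunits_iff_or, ← map_inv₀, ha,
      _root_.map_eq_zero]
    exact h1)
  have ha'i : ∀ h, (a' h).comp i' = i' := fun h ↦ RingHom.ext fun c ↦ Subtype.ext (hai h c)
  have hYv : ValuativeCriterion (Y ↘ Spec (.of K)) := by
    have h1 : IsProper (Y ↘ Spec (.of K)) := inferInstance
    rw [IsProper.eq_valuativeCriterion] at h1
    exact h1.1.1.1
  have hact : ∀ h, ρ.act h ≫ (Y ↘ Spec (.of K)) = Y ↘ Spec (.of K) := fun h ↦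
    (ρ.isOver h).comp_over
  let ι : Spec (.of L) ⟶ Spec (.of W) := Spec.map (CommRingCat.ofHom (algebraMap W L))
  let b : Spec (.of W) ⟶ Spec (.of K) := Spec.map (CommRingCat.ofHom i')
  have hb : ∀ h, Spec.map (CommRingCat.ofHom (a' h)) ≫ b = b := fun h ↦ by
    rw [← Spec.map_comp, ← CommRingCat.ofHom_comp, ha'i]
  have hιa : ∀ h, ι ≫ Spec.map (CommRingCat.ofHom (a' h)) =
      Spec.map (CommRingCat.ofHom (a h)) ≫ ι := fun h ↦ by
    rw [← Spec.map_comp, ← Spec.map_comp, ← CommRingCat.ofHom_comp, ← CommRingCat.ofHom_comp]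
    rfl
  have hιb : ι ≫ b = Spec.map (CommRingCat.ofHom i) := by
    rw [← Spec.map_comp, ← CommRingCat.ofHom_comp]
    rfl
  obtain ⟨⟨l, hl₁, hl₂⟩⟩ := ((hYv.existence) ⟨W, L, y, b, ⟨hy.trans hιb.symm⟩⟩).exists_lift
  -- Both sides lift the same square, by equivariance of `y`; the uniqueness part of the criterion
  -- identifies them.
  have hla : ∀ h, l ≫ ρ.act h = Spec.map (CommRingCat.ofHom (a' h)) ≫ l := fun h ↦ by
    have hsq : CommSq (y ≫ ρ.act h) ι (Y ↘ Spec (.of K)) b :=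
      ⟨by rw [Category.assoc, hact, hy, hιb]⟩
    have := hYv.uniqueness ⟨W, L, y ≫ ρ.act h, b, hsq⟩
    have h2 : (⟨l ≫ ρ.act h, by rw [reassoc_of% hl₁], by rw [Category.assoc, hact, hl₂]⟩ :
        hsq.LiftStruct) = ⟨Spec.map (CommRingCat.ofHom (a' h)) ≫ l, by
          rw [reassoc_of% (hιa h), hl₁, hya], by rw [Category.assoc, hl₂, hb]⟩ :=
      Subsingleton.elim _ _
    exact congr_arg CommSq.LiftStruct.l h2
  refine ⟨Spec.map (CommRingCat.ofHom r) ≫ l, ?_, fun h ↦ ?_⟩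
  · rw [Category.assoc, hl₂, ← Spec.map_comp, ← CommRingCat.ofHom_comp, hri]
    exact Spec.map_id _
  · rw [Category.assoc, hla, ← Category.assoc, ← Spec.map_comp, ← CommRingCat.ofHom_comp, hra]

end FixedPoint


/-! ### Rational maps at the generic point. -/

section FunctionField

open IsLocalRing Scheme

variable {X Y Z : Scheme.{u}} [IrreducibleSpace X]

theorem fromFunctionField_compHom (f : X ⤏ Y) (g : Y ⟶ Z) :
    (f.compHom g).fromFunctionField = f.fromFunctionField ≫ g := by
  obtain ⟨f, rfl⟩ := f.exists_rep
  rw [← RationalMap.compHom_toRationalMap, RationalMap.fromFunctionField_toRationalMap,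
    RationalMap.fromFunctionField_toRationalMap]
  exact f.fromSpecStalkOfMem_compHom g _ _

theorem fromFunctionField_hom_toRationalMap (f : X ⟶ Y) :
    f.toRationalMap.fromFunctionField = X.fromSpecStalk (genericPoint X) ≫ f := by
  exact PartialMap.fromSpecStalkOfMem_toPartialMap f _

theorem fromFunctionField_comp_over {S : Scheme.{u}} [X.Over S] [Y.Over S] (f : X ⤏ Y)
    (hf : f.IsOver S) :
    f.fromFunctionField ≫ (Y ↘ S) = X.fromSpecStalk (genericPoint X) ≫ (X ↘ S) := by
  rw [← fromFunctionField_compHom, RationalMap.isOver_iff.mp hf,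
    fromFunctionField_hom_toRationalMap]

theorem fromFunctionField_comp [IrreducibleSpace Y] (g : X ⟶ Y) [IsDominant g] (f : Y ⤏ Z)
    (φ : Spec X.functionField ⟶ Spec Y.functionField)
    (hφ : φ ≫ Y.fromSpecStalk (genericPoint Y) = X.fromSpecStalk (genericPoint X) ≫ g) :
    (g.toRationalMap.comp f).fromFunctionField = φ ≫ f.fromFunctionField := by
  obtain ⟨f, rfl⟩ := f.exists_rep
  change (g.toPartialMap.toRationalMap.comp f.toRationalMap).fromFunctionField = _
  rw [RationalMap.toRationalMap_comp,
    RationalMap.fromFunctionField_toRationalMap, RationalMap.fromFunctionField_toRationalMap]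
  have h2 : genericPoint Y ∈ f.domain :=
    (genericPoint_specializes _).mem_open f.domain.2 f.dense_domain.nonempty.choose_spec
  have h1 : genericPoint X ∈ (⊤ : X.Opens).ι ''ᵁ (X.topIso.hom ≫ g) ⁻¹ᵁ f.domain :=
    (genericPoint_specializes _).mem_open (g.toPartialMap.comp f).domain.2
      (g.toPartialMap.comp f).dense_domain.nonempty.choose_spec
  have key : ((⊤ : X.Opens).ι ''ᵁ (X.topIso.hom ≫ g) ⁻¹ᵁ f.domain).fromSpecStalkOfMem _ h1 ≫
      ((⊤ : X.Opens).ι.isoImage ((X.topIso.hom ≫ g) ⁻¹ᵁ f.domain)).inv ≫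
        ((X.topIso.hom ≫ g) ∣_ f.domain) = φ ≫ f.domain.fromSpecStalkOfMem _ h2 := by
    rw [← cancel_mono f.domain.ι]
    simp only [Category.assoc]
    rw [Opens.fromSpecStalkOfMem_ι, hφ, morphismRestrict_ι]
    refine (congr_arg (_ ≫ ·) (Scheme.Hom.isoImage_inv_ι_assoc (⊤ : X.Opens).ι _ g)).trans ?_
    exact Opens.fromSpecStalkOfMem_ι_assoc _ _ _ g
  have key' := congr_arg (· ≫ f.hom) key
  simp only [Category.assoc] at key'
  exact key'

theorem fromFunctionField_closedPoint [IrreducibleSpace Y] (f : X ⤏ Y) (hf : f.IsDominant) :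
    f.fromFunctionField (closedPoint X.functionField) = genericPoint Y := by
  obtain ⟨f, rfl⟩ := f.exists_rep
  rw [PartialMap.isDominant_toRationalMap_iff] at hf
  rw [RationalMap.fromFunctionField_toRationalMap]
  have h1 : genericPoint X ∈ f.domain :=
    (genericPoint_specializes _).mem_open f.domain.2 f.dense_domain.nonempty.choose_spec
  have h2 : f.domain.fromSpecStalkOfMem _ h1 (closedPoint X.functionField) =
      ⟨genericPoint X, h1⟩ := by
    apply f.domain.ι.isOpenEmbedding.injective
    change (f.domain.fromSpecStalkOfMem (genericPoint X) h1 ≫ f.domain.ι) _ = _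
    rw [Opens.fromSpecStalkOfMem_ι]
    exact fromSpecStalk_closedPoint
  have : IrreducibleSpace f.domain :=
    have : Nonempty f.domain := ⟨⟨_, h1⟩⟩
    f.domain.ι.isOpenEmbedding.irreducibleSpace
  have h3 : genericPoint f.domain = ⟨genericPoint X, h1⟩ :=
    f.domain.ι.isOpenEmbedding.injective (genericPoint_eq_of_isOpenImmersion f.domain.ι)
  change f.hom (f.domain.fromSpecStalkOfMem _ h1 (closedPoint X.functionField)) = _
  rw [h2, ← h3]
  refine ((genericPoint_spec _).image f.hom.continuous).eq ?_
  rw [Set.image_univ, f.hom.denseRange.closure_range]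
  exact genericPoint_spec Y

end FunctionField

/-! ### Actions induced on local rings and residue fields. -/

section Actions

open IsLocalRing Scheme

variable {S : Scheme.{u}} {H : Type v} [CommGroup H]

theorem exists_comp_fromSpecStalk {X Y : Scheme.{u}} (f : X ⟶ Y) {x : X} {y : Y} (h : f x = y) :
    ∃ φ : Spec (X.presheaf.stalk x) ⟶ Spec (Y.presheaf.stalk y),
      φ ≫ Y.fromSpecStalk y = X.fromSpecStalk x ≫ f := by
  subst h
  exact ⟨Spec.map (f.stalkMap x), SpecMap_stalkMap_fromSpecStalk f⟩

theorem exists_comp_fromSpecResidueField {X Y : Scheme.{u}} (f : X ⟶ Y) {x : X} {y : Y}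
    (h : f x = y) : ∃ φ : Spec (X.residueField x) ⟶ Spec (Y.residueField y),
      φ ≫ Y.fromSpecResidueField y = X.fromSpecResidueField x ≫ f := by
  subst h
  exact ⟨Spec.map (f.residueFieldMap x), Hom.SpecMap_residueFieldMap_fromSpecResidueField f x⟩

theorem SchemeAction.act_mul {X : Scheme.{u}} [X.Over S] (ρ : SchemeAction S H X) (g h : H) :
    ρ.act (g * h) = ρ.act h ≫ ρ.act g := by
  rw [SchemeAction.act, map_mul]
  rfl

theorem SchemeAction.act_one {X : Scheme.{u}} [X.Over S] (ρ : SchemeAction S H X) :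
    ρ.act 1 = 𝟙 X := by
  rw [SchemeAction.act, map_one]
  rfl

/-- An action of a commutative group restricts to the spectrum of a ring `A` mapping
monomorphically to the scheme if all the automorphisms restrict. -/
theorem SchemeAction.exists_ringHom {X : Scheme.{u}} [X.Over S] (ρ : SchemeAction S H X)
    {A : Type u} [CommRing A] (t : Spec (.of A) ⟶ X) [Mono t]
    (ht : ∀ h, ∃ φ : Spec (.of A) ⟶ Spec (.of A), φ ≫ t = t ≫ ρ.act h) :
    ∃ a : H →* (A →+* A), ∀ h, Spec.map (CommRingCat.ofHom (a h)) ≫ t = t ≫ ρ.act h := by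
  have ht' : ∀ h, ∃ b : A →+* A, Spec.map (CommRingCat.ofHom b) ≫ t = t ≫ ρ.act h := fun h ↦ by
    obtain ⟨φ, hφ⟩ := ht h
    exact ⟨(Spec.preimage φ).hom, by rw [CommRingCat.ofHom_hom, Spec.map_preimage, hφ]⟩
  choose b hb using ht'
  have key : ∀ c d : A →+* A,
      Spec.map (CommRingCat.ofHom c) ≫ t = Spec.map (CommRingCat.ofHom d) ≫ t → c = d :=
    fun c d h ↦ by
      rw [cancel_mono, Spec.map_inj] at h
      exact congr_arg CommRingCat.Hom.hom h
  exact ⟨{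
    toFun := b
    map_one' := key _ _ (by
      rw [hb, ρ.act_one, Category.comp_id]
      exact (Category.id_comp t).symm.trans (congr_arg (· ≫ t) (Spec.map_id _).symm))
    -- Passing to rings reverses composition; commutativity of `H` restores a homomorphism.
    map_mul' := fun g h ↦ key _ _ (by
      change _ = Spec.map (CommRingCat.ofHom ((b g).comp (b h))) ≫ t
      rw [hb, CommRingCat.ofHom_comp, Spec.map_comp, Category.assoc, hb, reassoc_of% (hb g),
        mul_comm, ρ.act_mul]) }, hb⟩

/-- A preimmersion is surjective on stalks; at the zero ideal this writes each element of `M` as a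
fraction. -/
theorem isFractionRing_of_isPreimmersion {R M : Type u} [CommRing R] [Field M] [Algebra R M]
    [IsPreimmersion (Spec.map (CommRingCat.ofHom (algebraMap R M)))]
    (hinj : Function.Injective (algebraMap R M)) : IsFractionRing R M := by
  have h1 := (IsPreimmersion.SpecMap_iff (CommRingCat.ofHom (algebraMap R M))).mp inferInstance
  have h2 := RingHom.surjectiveOnStalks_iff_forall_ideal.mp h1.2 ⊥ bot_ne_top
  have : FaithfulSMul R M := (faithfulSMul_iff_algebraMap_injective R M).mpr hinj
  have : IsDomain R := hinj.isDomain _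
  refine IsFractionRing.of_field R M fun z ↦ ?_
  obtain ⟨x, r, c, hc, hr, e⟩ : ∃ (x r : R) (c : M), c ≠ 0 ∧ algebraMap R M r ≠ 0 ∧
      c * algebraMap R M r * z = c * algebraMap R M x := by
    obtain ⟨x, r, c, hc, hr, e⟩ := h2 z
    exact ⟨x, r, c, hc, hr, e⟩
  refine ⟨x, r, ?_⟩
  rw [eq_div_iff hr, mul_comm]
  rw [mul_assoc] at e
  exact mul_left_cancel₀ hc e

end Actions


/-! ### The local ring at a smooth rational point. -/

section SmoothPoint

open IsLocalRing Scheme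

variable {K : Type u} [Field K] {Z : Scheme.{u}}

theorem formallySmooth_stalkMap {U S : Scheme.{u}} (f : U ⟶ Z) [IsOpenImmersion f] (π : Z ⟶ S)
    [Smooth (f ≫ π)] (x : U) : (π.stalkMap (f x)).hom.FormallySmooth := by
  have h : ((f ≫ π).stalkMap x).hom.FormallySmooth := by
    rw [← Scheme.Hom.mem_smoothLocus, Scheme.Hom.smoothLocus_eq_top]
    trivial
  rw [Scheme.Hom.stalkMap_comp] at h
  exact (RingHom.FormallySmooth.respectsIso.cancel_right_isIso _ (f.stalkMap x)).mp h

theorem exists_formallySmooth_fromSpecStalk (A : CommRingCat.{u}) (x : PrimeSpectrum A) :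
    ∃ e : A ⟶ (Spec A).presheaf.stalk x, e.hom.FormallySmooth ∧
      (Spec A).fromSpecStalk x = Spec.map e := by
  refine ⟨CommRingCat.ofHom (algebraMap A (Localization.AtPrime x.asIdeal)) ≫
    (Spec.stalkIso A x).inv, ?_, ?_⟩
  · rw [CommRingCat.hom_comp]
    exact RingHom.FormallySmooth.comp (RingHom.formallySmooth_algebraMap.mpr
      (Algebra.FormallySmooth.of_isLocalization x.asIdeal.primeCompl))
      (RingHom.FormallySmooth.of_bijective
        (ConcreteCategory.bijective_of_isIso (Spec.stalkIso A x).inv))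
  · rw [Spec.algebraMap_stalkIso_inv]
    exact Spec.fromSpecStalk_eq _ _

/-- Smoothness of the stalk map is over the local ring of `Spec K`; composing with the localization
of `K` gives it over `K`. -/
theorem formallySmooth_stalk {U : Scheme.{u}} (f : U ⟶ Z) [IsOpenImmersion f]
    (π : Z ⟶ Spec (.of K)) [Smooth (f ≫ π)] {x : U} {z : Z} (hz : f x = z)
    (i : CommRingCat.of K ⟶ Z.presheaf.stalk z) (hi : Spec.map i = Z.fromSpecStalk z ≫ π) :
    i.hom.FormallySmooth := by
  subst hz
  obtain ⟨e, he, he'⟩ := exists_formallySmooth_fromSpecStalk (.of K) (π (f x))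
  have h1 : i = e ≫ π.stalkMap (f x) := by
    rw [← Spec.map_inj, hi, ← SpecMap_stalkMap_fromSpecStalk]
    exact (congr_arg (Spec.map (π.stalkMap (f x)) ≫ ·) he').trans
      (Spec.map_comp e (π.stalkMap (f x))).symm
  rw [h1]
  exact RingHom.FormallySmooth.comp he (formallySmooth_stalkMap f π x)

theorem isNoetherianRing_stalk {U : Scheme.{u}} (f : U ⟶ Z) [IsOpenImmersion f]
    (π : Z ⟶ Spec (.of K)) [Smooth (f ≫ π)] {x : U} {z : Z} (hz : f x = z) :
    IsNoetherianRing (Z.presheaf.stalk z) := by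
  subst hz
  have : IsLocallyNoetherian U := LocallyOfFiniteType.isLocallyNoetherian (f ≫ π)
  exact isNoetherianRing_of_ringEquiv _ (asIso (f.stalkMap x)).symm.commRingCatIsoToRingEquiv

/-- The point induces a retraction of the local ring onto `K`, which supplies the residue `c`. -/
theorem exists_residue_of_point (π : Z ⟶ Spec (.of K)) (z : Spec (.of K) ⟶ Z)
    (hz : z ≫ π = 𝟙 _) (i : CommRingCat.of K ⟶ Z.presheaf.stalk (z (closedPoint K)))
    (hi : Spec.map i = Z.fromSpecStalk _ ≫ π) (r : Z.presheaf.stalk (z (closedPoint K))) :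
    ∃ c : K, r - i.hom c ∈ maximalIdeal (Z.presheaf.stalk (z (closedPoint K))) := by
  have h1 : i ≫ stalkClosedPointTo z = 𝟙 _ := by
    rw [← Spec.map_inj, Spec.map_comp, hi, Spec_stalkClosedPointTo_fromSpecStalk_assoc, hz]
    exact (Spec.map_id _).symm
  refine ⟨(stalkClosedPointTo z).hom r, fun hu ↦ ?_⟩
  have h2 := hu.map (stalkClosedPointTo z).hom
  rw [map_sub, ← CommRingCat.comp_apply, h1, CommRingCat.id_apply, sub_self] at h2
  exact not_isUnit_zero h2

theorem eq_bot_of_fromSpecStalk_eq_genericPoint [IrreducibleSpace Z] {z : Z}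
    [IsDomain (Z.presheaf.stalk z)] {w : Spec (Z.presheaf.stalk z)}
    (hw : Z.fromSpecStalk z w = genericPoint Z) : w = (⊥ : PrimeSpectrum (Z.presheaf.stalk z)) := by
  have h1 : (⊥ : PrimeSpectrum (Z.presheaf.stalk z)) ⤳ w :=
    (PrimeSpectrum.le_iff_specializes _ _).mp bot_le
  have h2 := h1.map (Z.fromSpecStalk z).continuous
  rw [hw] at h2
  refine (Z.fromSpecStalk z).isEmbedding.injective ?_
  rw [hw]
  exact ((genericPoint_specializes _).antisymm h2).eq

end SmoothPoint

/-! ### The residue field at the generic point; the stalk need not be a field, as `X` need not be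
reduced. -/

section GenericPoint

open IsLocalRing Scheme

/-- The closed point of the spectrum of the local ring at the generic point. -/
noncomputable def genericClosedPoint (X : Scheme.{u}) [IrreducibleSpace X] :
    Spec X.functionField :=
  closedPoint X.functionField

/-- The residue field of an irreducible scheme at its generic point. -/
noncomputable abbrev genericResidueField (X : Scheme.{u}) [IrreducibleSpace X] : CommRingCat.{u} :=
  (Spec X.functionField).residueField (genericClosedPoint X)

/-- The spectrum of the residue field at the generic point, over the spectrum of the local ring. -/
noncomputable abbrev genericResidueHom (X : Scheme.{u}) [IrreducibleSpace X] :
    Spec (genericResidueField X) ⟶ Spec X.functionField :=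
  (Spec X.functionField).fromSpecResidueField (genericClosedPoint X)

theorem fromSpecStalk_genericClosedPoint (X : Scheme.{u}) [IrreducibleSpace X] :
    X.fromSpecStalk (genericPoint X) (genericClosedPoint X) = genericPoint X :=
  fromSpecStalk_closedPoint

theorem exists_comp_genericResidueHom {X : Scheme.{u}} [IrreducibleSpace X] (f : X ⟶ X)
    [IsIso f] : ∃ φ : Spec (genericResidueField X) ⟶ Spec (genericResidueField X),
      φ ≫ genericResidueHom X ≫ X.fromSpecStalk (genericPoint X) =
        (genericResidueHom X ≫ X.fromSpecStalk (genericPoint X)) ≫ f := by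
  obtain ⟨ψ, hψ⟩ := exists_comp_fromSpecStalk f (genericPoint_eq_of_isOpenImmersion f)
  have h1 : ψ (genericClosedPoint X) = genericClosedPoint X := by
    apply (X.fromSpecStalk (genericPoint X)).isEmbedding.injective
    change (ψ ≫ X.fromSpecStalk (genericPoint X)) (genericClosedPoint X) = _
    rw [hψ]
    change f (X.fromSpecStalk (genericPoint X) (genericClosedPoint X)) = _
    rw [fromSpecStalk_genericClosedPoint, genericPoint_eq_of_isOpenImmersion f]
  obtain ⟨φ, hφ⟩ := exists_comp_fromSpecResidueField ψ h1
  exact ⟨φ, by rw [reassoc_of% hφ, hψ, Category.assoc]⟩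

variable {S : Scheme.{u}} {H : Type v} [CommGroup H]

/-- An equivariant rational map is equivariant at the generic point. -/
theorem IsEquivariant.comp_fromFunctionField {X Y : Scheme.{u}} [X.Over S] [Y.Over S]
    [IrreducibleSpace X] {ρX : SchemeAction S H X} {ρY : SchemeAction S H Y} {f : X ⤏ Y}
    (hf : IsEquivariant ρX ρY f) (h : H)
    (φ : Spec (genericResidueField X) ⟶ Spec (genericResidueField X))
    (hφ : φ ≫ genericResidueHom X ≫ X.fromSpecStalk (genericPoint X) =
      (genericResidueHom X ≫ X.fromSpecStalk (genericPoint X)) ≫ ρX.act h) :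
    φ ≫ genericResidueHom X ≫ f.fromFunctionField =
      (genericResidueHom X ≫ f.fromFunctionField) ≫ ρY.act h := by
  obtain ⟨ψ, hψ⟩ :=
    exists_comp_fromSpecStalk (ρX.act h) (genericPoint_eq_of_isOpenImmersion (ρX.act h))
  have h1 : φ ≫ genericResidueHom X = genericResidueHom X ≫ ψ := by
    rw [← cancel_mono (X.fromSpecStalk (genericPoint X)), Category.assoc, hφ, Category.assoc,
      Category.assoc, hψ]
  rw [reassoc_of% h1, ← fromFunctionField_comp (ρX.act h) f ψ hψ, hf h, fromFunctionField_compHom,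
    Category.assoc]

theorem ringHom_equivariant_of_mono {X : Scheme.{u}} {A B : Type u} [CommRing A] [CommRing B]
    (f : A →+* B) (a : A →+* A) (b : B →+* B) (t : Spec (.of A) ⟶ X) [Mono t] (g : X ⟶ X)
    (ha : Spec.map (CommRingCat.ofHom a) ≫ t = t ≫ g)
    (hb : Spec.map (CommRingCat.ofHom b) ≫ Spec.map (CommRingCat.ofHom f) ≫ t =
      (Spec.map (CommRingCat.ofHom f) ≫ t) ≫ g) (x : A) : b (f x) = f (a x) := by
  rw [Category.assoc, ← ha, ← Category.assoc, ← Category.assoc, cancel_mono, ← Spec.map_comp,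
    ← Spec.map_comp, Spec.map_inj] at hb
  exact congr_arg (fun k ↦ k.hom x) hb

end GenericPoint


/-! ### Assembly of the invariant valuation ring on `X`. -/

section Main

open IsLocalRing Scheme

variable {K : Type u} [Field K] [IsAlgClosed K] {H : Type v} [CommGroup H] [Finite H]

set_option maxHeartbeats 1000000 in
/-- The residue field of `X` at its generic point has an invariant valuation ring, containing the
ground field, whose residue field is the ground field. -/
theorem exists_invariant_valuationSubring_genericResidueField {q : ℕ} [Fact q.Prime]
    (hH : IsPGroup q H) {X Z : Scheme.{u}} [X.Over (Spec (.of K))] [Z.Over (Spec (.of K))]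
    [IrreducibleSpace X] [IrreducibleSpace Z] (ρX : SchemeAction (Spec (.of K)) H X)
    (ρZ : SchemeAction (Spec (.of K)) H Z) (p : X ⤏ Z) (hpK : p.IsOver (Spec (.of K)))
    (hp : IsEquivariant ρX ρZ p) (hfin : IsGenericallyFinite p) (hdom : p.IsDominant)
    (hdeg : ¬ q ∣ degree p) (hZ : ρZ.HasSmoothFixedPoint) :
    ∃ (γ : H → genericResidueField X →+* genericResidueField X)
      (i : K →+* genericResidueField X) (W : ValuationSubring (genericResidueField X)),
      (∀ h, Spec.map (CommRingCat.ofHom (γ h)) ≫ genericResidueHom X ≫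
        X.fromSpecStalk (genericPoint X) =
          (genericResidueHom X ≫ X.fromSpecStalk (genericPoint X)) ≫ ρX.act h) ∧
      genericResidueHom X ≫ X.fromSpecStalk (genericPoint X) ≫ (X ↘ Spec (.of K)) =
        Spec.map (CommRingCat.ofHom i) ∧
      (∀ h c, γ h (i c) = i c) ∧ (∀ c, i c ∈ W) ∧ (∀ x ∈ W, ∃ c : K, x - i c ∈ W.nonunits) ∧
      ∀ h x, γ h x ∈ W ↔ x ∈ W := by
  obtain ⟨z, hz, U, hzU, hU⟩ := hZ
  let π : Z ⟶ Spec (.of K) := Z ↘ Spec (.of K)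
  have hact : ∀ h, ρZ.act h ≫ π = π := fun h ↦ (ρZ.isOver h).comp_over
  let zpt : Z := z (closedPoint K)
  have hzact : ∀ h, ρZ.act h zpt = zpt := fun h ↦
    congr_arg (fun f : Spec (.of K) ⟶ Z ↦ f (closedPoint K)) (hz.comp_act h)
  have hzU' : U.ι ⟨zpt, hzU⟩ = zpt := rfl
  -- the local ring of `Z` at the fixed point
  let R := Z.presheaf.stalk zpt
  have : IsNoetherianRing R := isNoetherianRing_stalk U.ι π hzU'
  let i : CommRingCat.of K ⟶ R := Spec.preimage (Z.fromSpecStalk zpt ≫ π)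
  have hi : Spec.map i = Z.fromSpecStalk zpt ≫ π := Spec.map_preimage _
  let : Algebra K R := i.hom.toAlgebra
  have : Algebra.FormallySmooth K R := formallySmooth_stalk U.ι π hzU' i hi
  have hres : ∀ r : R, ∃ c : K, r - algebraMap K R c ∈ maximalIdeal R :=
    exists_residue_of_point π z hz.comp_over i hi
  -- A monomial system already forces a domain; the trivial action suffices to obtain one.
  have : IsDomain R := by
    obtain ⟨n, t, ht, -⟩ := exists_isMonomialSystem hres (1 : H →* (R ≃ₐ[K] R))
    exact ht.isDomain
  let tR : Spec (.of R) ⟶ Z := Z.fromSpecStalk zpt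
  have : Mono tR := inferInstanceAs (Mono (Z.fromSpecStalk zpt))
  have hi' : Spec.map (CommRingCat.ofHom (algebraMap K R)) = tR ≫ π := hi
  obtain ⟨α, hα⟩ := ρZ.exists_ringHom tR fun h ↦ exists_comp_fromSpecStalk (ρZ.act h) (hzact h)
  -- the residue field of `Z` at the generic point
  let η : Z := p.fromFunctionField (genericClosedPoint X)
  have hη : η = genericPoint Z := fromFunctionField_closedPoint p hdom
  let M := Z.residueField η
  let tM : Spec (.of M) ⟶ Z := Z.fromSpecResidueField η
  have htM : IsPreimmersion tM := inferInstanceAs (IsPreimmersion (Z.fromSpecResidueField η))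
  obtain ⟨β, hβ⟩ := ρZ.exists_ringHom tM fun h ↦
    exists_comp_fromSpecResidueField (ρZ.act h) (x := η) (y := η)
      (by rw [hη, genericPoint_eq_of_isOpenImmersion])
  have hηz : η ⤳ zpt := hη ▸ genericPoint_specializes zpt
  let j : R ⟶ M := Z.presheaf.stalkSpecializes hηz ≫ Z.residue η
  let : Algebra R M := j.hom.toAlgebra
  have hj : Spec.map (CommRingCat.ofHom (algebraMap R M)) ≫ tR = tM := by
    change Spec.map (Z.presheaf.stalkSpecializes hηz ≫ Z.residue η) ≫ Z.fromSpecStalk zpt = _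
    rw [Spec.map_comp, Category.assoc, SpecMap_stalkSpecializes_fromSpecStalk]
    rfl
  have : IsPreimmersion (Spec.map (CommRingCat.ofHom (algebraMap R M))) := by
    have : IsPreimmersion (Spec.map (CommRingCat.ofHom (algebraMap R M)) ≫ tR) := hj ▸ htM
    have : IsPreimmersion tR := inferInstanceAs (IsPreimmersion (Z.fromSpecStalk zpt))
    exact IsPreimmersion.of_comp _ tR
  -- By dominance `η` is the generic point of `Z`, which corresponds to the zero ideal of the domain
  -- `R`, and the kernel is that ideal.
  have hjinj : Function.Injective (algebraMap R M) := by
    let w : Spec (.of R) := Spec.map (CommRingCat.ofHom (algebraMap R M)) (⊥ : PrimeSpectrum M)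
    have hw : w = (⊥ : PrimeSpectrum R) := by
      apply eq_bot_of_fromSpecStalk_eq_genericPoint (z := zpt) (w := w)
      change (Spec.map (CommRingCat.ofHom (algebraMap R M)) ≫ tR) _ = _
      rw [hj, ← hη]
      exact Z.fromSpecResidueField_apply η _
    rw [injective_iff_map_eq_zero]
    intro r hr
    have h1 : r ∈ PrimeSpectrum.asIdeal w := hr
    rw [hw] at h1
    exact h1
  have : IsFractionRing R M := isFractionRing_of_isPreimmersion hjinj
  -- the residue field of `X` at the generic point
  let L := genericResidueField X
  let tL : Spec (.of L) ⟶ X := genericResidueHom X ≫ X.fromSpecStalk (genericPoint X)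
  have : Mono tL :=
    inferInstanceAs (Mono (genericResidueHom X ≫ X.fromSpecStalk (genericPoint X)))
  have hγ' : ∀ h, ∃ φ : Spec (.of L) ⟶ Spec (.of L), φ ≫ tL = tL ≫ ρX.act h :=
    fun h ↦ exists_comp_genericResidueHom (ρX.act h)
  obtain ⟨γ, hγ⟩ := ρX.exists_ringHom tL hγ'
  let k : M ⟶ L := p.fromFunctionField.residueFieldMap (genericClosedPoint X)
  let : Algebra M L := k.hom.toAlgebra
  have hk : Spec.map (CommRingCat.ofHom (algebraMap M L)) ≫ tM =
      genericResidueHom X ≫ p.fromFunctionField :=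
    Hom.SpecMap_residueFieldMap_fromSpecResidueField _ _
  have : FiniteDimensional M L := hfin
  have hdeg' : ¬ q ∣ Module.finrank M L := hdeg
  have hαi : ∀ h c, α h (algebraMap K R c) = algebraMap K R c := fun h c ↦ by
    have h1 : Spec.map (CommRingCat.ofHom (algebraMap K R) ≫ CommRingCat.ofHom (α h)) =
        Spec.map (CommRingCat.ofHom (algebraMap K R)) := by
      rw [Spec.map_comp, hi', reassoc_of% (hα h), hact]
    exact congr_arg (fun f ↦ f.hom c) (Spec.map_injective h1)
  have hβα : ∀ h r, β h (algebraMap R M r) = algebraMap R M (α h r) := fun h r ↦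
    ringHom_equivariant_of_mono (algebraMap R M) (α h) (β h) tR (ρZ.act h) (hα h)
      (by rw [hj]; exact hβ h) r
  have hγβ : ∀ h m, γ h (algebraMap M L m) = algebraMap M L (β h m) := fun h m ↦
    ringHom_equivariant_of_mono (algebraMap M L) (β h) (γ h) tM (ρZ.act h) (hβ h)
      (by rw [hk]; exact hp.comp_fromFunctionField h _ (hγ h)) m
  obtain ⟨W, hW₁, hW₂, hW₃⟩ := exists_invariant_valuationSubring_of_formallySmooth_subring
    hH hres hdeg' α hαi β hβα γ hγβ
  refine ⟨γ, (algebraMap M L).comp ((algebraMap R M).comp (algebraMap K R)), W, hγ, ?_,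
    fun h c ↦ ?_, hW₁, hW₂, hW₃⟩
  · rw [← fromFunctionField_comp_over p hpK, ← Category.assoc, ← hk,
      CommRingCat.ofHom_comp, CommRingCat.ofHom_comp, Spec.map_comp, Spec.map_comp, ← hj, hi']
    simp only [Category.assoc]
    rfl
  · rw [RingHom.comp_apply, RingHom.comp_apply, hγβ, hβα, hαi]

end Main

end GoingUp

theorem mainTheorem2
    {K : Type u} [Field K] [IsAlgClosed K]
    {H : Type v} [CommGroup H] [Finite H]
    (q n : ℕ) (hq : q.Prime) (hH : Nat.card H = q ^ n)
    {X Z : Scheme.{u}} [X.Over (Spec (.of K))] [Z.Over (Spec (.of K))]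
    [IrreducibleSpace X] [IrreducibleSpace Z]
    (ρX : GoingUp.SchemeAction (Spec (.of K)) H X)
    (ρZ : GoingUp.SchemeAction (Spec (.of K)) H Z)
    (p : X ⤏ Z) (hpK : p.IsOver (Spec (.of K))) (hp : GoingUp.IsEquivariant ρX ρZ p)
    (hfin : GoingUp.IsGenericallyFinite p) (hdom : p.IsDominant)
    (hdeg : ¬ q ∣ GoingUp.degree p)
    (hZ : ρZ.HasSmoothFixedPoint)
    (hX : IsProper (X ↘ Spec (.of K))) :
    ρX.HasFixedPoint ∧
      ∀ (Y : Scheme.{u}) [Y.Over (Spec (.of K))] (ρY : GoingUp.SchemeAction (Spec (.of K)) H Y)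
        (f : X ⤏ Y), IsProper (Y ↘ Spec (.of K)) → f.IsOver (Spec (.of K)) →
        GoingUp.IsEquivariant ρX ρY f → ρY.HasFixedPoint := by
  have : Fact q.Prime := ⟨hq⟩
  obtain ⟨γ, i, W, hγ, hi, hγi, hiW, hres, hW⟩ :=
    GoingUp.exists_invariant_valuationSubring_genericResidueField (IsPGroup.of_card hH) ρX ρZ p hpK
      hp hfin hdom hdeg hZ
  refine ⟨?_, fun Y _ ρY f hY hfK hf ↦ ?_⟩
  -- The same `W` serves both claims; only the `L`-point being specialized changes.
  · exact GoingUp.hasFixedPoint_of_valuationSubring ρX i γ hγi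
      (GoingUp.genericResidueHom X ≫ X.fromSpecStalk (genericPoint X))
      ((Category.assoc _ _ _).trans hi) hγ W hiW hres hW
  · exact GoingUp.hasFixedPoint_of_valuationSubring ρY i γ hγi
      (GoingUp.genericResidueHom X ≫ f.fromFunctionField)
      (by rw [Category.assoc, GoingUp.fromFunctionField_comp_over f hfK]; exact hi)
      (fun h ↦ hf.comp_fromFunctionField h _ (hγ h)) W hiW hres hW
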